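/- Let $m\ge 2$ and let $d_1<\dots<d_m$ be a minimal generating set, consisting of positive integers, of a numerical semigroup $S=S(\mathbf d^m)=\{\sum_i x_id_i : x_i\in\mathbb Z_{\ge 0}\}$, i.e. $\mathbb N\setminus S$ is finite and no $d_i$ is a combination of the other generators with non-negative integer coefficients. Put $\Sigma_m=d_1+\dots+d_m$, let $c=\min\{s\in S : s+\mathbb Z_{\ge0}\subseteq S\}$ be the conductor and $F=c-1$ the Frobenius number. Let $$S'=\{f\in\mathbb Z : f\notin S,\ f+s\in S \text{ for all } s\in S\setminus\{0\}\},\qquad \Delta_{\mathcal H}=\{h\in\mathbb Z : h\notin S,\ F-h\notin S\},\qquad \gamma=\#\Delta_{\mathcal H},$$ and assume that $S$ is almost symmetric, i.e. $S'\setminus\{F\}=\Delta_{\mathcal H}$. Let $k$ be a field of characteristic $0$ and let $P=k[X_1,\dots,X_m]$ be graded by $\deg X_i=d_i$. Let $\cdots\to P^{\beta_2}\to P^{\beta_1}\to P\to k[z^{d_1},\dots,z^{d_m}]\to0$ ($X_i\mapsto z^{d_i}$) be a minimal graded free resolution of the semigroup ring, with $P^{\beta_i}=\bigoplus_{j=1}^{\beta_i}P(-C_{j,i})$,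 so that the $\beta_i$ are the Betti numbers and the $C_{j,i}$ are the syzygy degrees. All of the following are finite multisets of integers; the join adds multiplicities, and the intersection $\wedge$ takes the minimum of multiplicities. Let $\mathfrak L_o$ (respectively $\mathfrak L_e$) be the multiset of all sums $d_{i_1}+\dots+d_{i_q}+h$ with $h\in\Delta_{\mathcal H}$, $1\le i_1<\dots<i_q\le m$, $1\le q\le m-1$ and $q$ odd (respectively even), one element for each choice of $h$ and of the indices. Let $\mathfrak B_o$ (respectively $\mathfrak B_e$) be the multiset of all $C_{j,i}$ with $1\le j\le\beta_i$, $1\le i\le m-2$ and $i$ odd (respectively even), and let $\overline{\mathfrak B}_o$, $\overline{\mathfrak B}_e$ be obtained from them by replacing each $C_{j,i}$ by $F+\Sigma_m-C_{j,i}$. If $m$ is even, let $\mathfrak X_1$ be the join of $\mathfrak B_o$ and $\overline{\mathfrak B}_o$, and $\mathfrak X_2$ the join of $\mathfrak B_e$ and $\overline{\mathfrak B}_e$; if $m$ is odd, let $\mathfrak X_1$ be the join of $\mathfrak B_o$ and $\overline{\mathfrak B}_e$, and $\mathfrak X_2$ the join of $\mathfrak B_e$ and $\overline{\mathfrak B}_o$.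 Put $$\ell=\#(\mathfrak L_e\wedge\mathfrak L_o),\qquad \wp=\#(\mathfrak X_1\wedge\mathfrak X_2),\qquad \delta=\wp-\ell .$$ Then $$\delta\le(d_1-\gamma)\,2^{m-1}-2m .$$ -/

import Mathlib

/-! Numerical semigroups, their gaps, almost symmetry, minimal graded free resolutions of the
semigroup ring, and the multisets of degrees attached to them. -/

namespace NumSgp

section Semigroup

variable {m : ℕ}

/-- The semigroup `S(d^m) = {∑ x_i d_i | x_i ∈ ℕ ∪ {0}}` generated by `d_1, …, d_m`. -/
def sgp (d : Fin m → ℕ) : AddSubmonoid ℕ := AddSubmonoid.closure (Set.range d)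

/-- `d_1 < … < d_m` is a minimal generating set, consisting of positive integers, of a numerical
semigroup (a semigroup with finite complement in `ℕ`). -/
structure IsMinimalGenerating (d : Fin m → ℕ) : Prop where
  pos : ∀ i, 0 < d i
  strictMono : StrictMono d
  finite_compl : ((sgp d : Set ℕ)ᶜ).Finite
  minimal : ∀ i, d i ∉ AddSubmonoid.closure (d '' {j | j ≠ i})

/-- The semigroup as a set of integers. -/
def sgpInt (d : Fin m → ℕ) : Set ℤ := (fun s : ℕ => (s : ℤ)) '' (sgp d : Set ℕ)

/-- The conductor `c = min {s ∈ S | s + (ℕ ∪ {0}) ⊆ S}`. -/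
noncomputable def conductor (d : Fin m → ℕ) : ℕ :=
  sInf {s : ℕ | s ∈ sgp d ∧ ∀ n : ℕ, s + n ∈ sgp d}

/-- The Frobenius number `F = c - 1`, an integer. -/
noncomputable def frob (d : Fin m → ℕ) : ℤ := (conductor d : ℤ) - 1

/-- `Σ_m = d_1 + … + d_m`. -/
def sumGen (d : Fin m → ℕ) : ℤ := ∑ i, (d i : ℤ)

/-- The set `S'` of integers `f ∉ S` with `f + s ∈ S` for all nonzero `s ∈ S`. -/
def pseudoFrob (d : Fin m → ℕ) : Set ℤ :=
  {f | f ∉ sgpInt d ∧ ∀ s ∈ sgpInt d, s ≠ 0 → f + s ∈ sgpInt d}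

open Classical in
/-- The set `Δ_H` of the gaps `h` with `F - h ∉ S`. As a gap is smaller than the conductor, the
search is restricted to `0 ≤ h < c`; see `mem_deltaH`. -/
noncomputable def deltaH (d : Fin m → ℕ) : Finset ℤ :=
  {h ∈ Finset.Ico (0 : ℤ) (conductor d) | h ∉ sgpInt d ∧ frob d - h ∉ sgpInt d}

theorem conductor_spec {d : Fin m → ℕ} (hd : IsMinimalGenerating d) :
    conductor d ∈ sgp d ∧ ∀ n : ℕ, conductor d + n ∈ sgp d := by
  have hne : {s : ℕ | s ∈ sgp d ∧ ∀ n : ℕ, s + n ∈ sgp d}.Nonempty := by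
    obtain ⟨b, hb⟩ := hd.finite_compl.bddAbove
    have key : ∀ n : ℕ, b + 1 + n ∈ sgp d := by
      intro n
      by_contra h
      have := hb (show b + 1 + n ∈ ((sgp d : Set ℕ)ᶜ) from h)
      omega
    exact ⟨b + 1, by simpa using key 0, key⟩
  exact Nat.sInf_mem hne

/-- No integer outside `0 ≤ h < c` is missed by the definition of `deltaH`. -/
theorem mem_deltaH {d : Fin m → ℕ} (hd : IsMinimalGenerating d) (h : ℤ) :
    h ∈ deltaH d ↔ h ∉ sgpInt d ∧ frob d - h ∉ sgpInt d := by
  have big : ∀ x : ℤ, (conductor d : ℤ) ≤ x → x ∈ sgpInt d := by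
    intro x hx
    refine ⟨conductor d + (x - conductor d).toNat, (conductor_spec hd).2 _, ?_⟩
    push_cast
    omega
  simp only [deltaH, Finset.mem_filter, Finset.mem_Ico, and_iff_right_iff_imp]
  rintro ⟨h1, h2⟩
  constructor
  · by_contra hneg
    exact h2 (big _ (by unfold frob; omega))
  · by_contra hge
    exact h1 (big _ (by omega))

/-- `γ`, the number of elements of `Δ_H`. -/
noncomputable def gam (d : Fin m → ℕ) : ℕ := (deltaH d).card

/-- The semigroup is almost symmetric: `S' \ {F} = Δ_H`. -/
def IsAlmostSymmetric (d : Fin m → ℕ) : Prop :=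
  pseudoFrob d \ {frob d} = (deltaH d : Set ℤ)

/-- The multiset `𝔇_i` of all sums of `i` generators with distinct indices, one element for each
set of `i` indices. -/
def genSums (d : Fin m → ℕ) (i : ℕ) : Multiset ℤ :=
  (Finset.powersetCard i (Finset.univ : Finset (Fin m))).val.map fun s => ∑ j ∈ s, (d j : ℤ)

/-- The join sumset `𝔏_i` of the multiset `𝔇_i` and `Δ_H`. -/
noncomputable def genGapSums (d : Fin m → ℕ) (i : ℕ) : Multiset ℤ :=
  (genSums d i ×ˢ (deltaH d).val).map fun p => p.1 + p.2

/-- `𝔏_o`, the join of the `𝔏_i` with `1 ≤ i ≤ m - 1`, `i` odd. -/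
noncomputable def genGapOdd (d : Fin m → ℕ) : Multiset ℤ :=
  ∑ i ∈ (Finset.Icc 1 (m - 1)).filter (fun i => Odd i), genGapSums d i

/-- `𝔏_e`, the join of the `𝔏_i` with `1 ≤ i ≤ m - 1`, `i` even. -/
noncomputable def genGapEven (d : Fin m → ℕ) : Multiset ℤ :=
  ∑ i ∈ (Finset.Icc 1 (m - 1)).filter (fun i => Even i), genGapSums d i

/-- `ℓ`, the cardinality of `𝔐₁₂ = 𝔏_e ⋀ 𝔏_o` (multiplicities are minima). -/
noncomputable def ell (d : Fin m → ℕ) : ℕ := Multiset.card (genGapEven d ∩ genGapOdd d)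

end Semigroup

section Resolution

/-- The kernel of `K[X_1, …, X_m] → K[z]`, `X_i ↦ z ^ d_i`; the image of this map is the
semigroup ring `K[z^{d_1}, …, z^{d_m}]`. -/
noncomputable def toricIdeal (K : Type*) [Field K] {m : ℕ} (d : Fin m → ℕ) :
    Ideal (MvPolynomial (Fin m) K) :=
  RingHom.ker (MvPolynomial.aeval (R := K) fun i => (Polynomial.X : Polynomial K) ^ d i)

/-- A minimal graded free resolution `⋯ → P^{β_2} → P^{β_1} → P → K[z^{d_1}, …, z^{d_m}] → 0` of
the semigroup ring over `P = K[X_1, …, X_m]`, graded by `deg X_i = d_i`: here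
`P^{β_i} = ⨁_j P(-C_{j,i})`, the differentials are given by matrices of homogeneous polynomials
that preserve the degrees, and minimality says that the entries of these matrices lie in the ideal
`(X_1, …, X_m)`. -/
structure MinimalResolution (K : Type*) [Field K] {m : ℕ} (d : Fin m → ℕ) where
  /-- the Betti numbers `β_i` -/
  betti : ℕ → ℕ
  /-- the syzygy degrees `C_{j,i}` -/
  deg : (i : ℕ) → Fin (betti i) → ℕ
  /-- the differentials `P^{β_{i+1}} → P^{β_i}` -/
  diff : (i : ℕ) → Matrix (Fin (betti i)) (Fin (betti (i + 1))) (MvPolynomial (Fin m) K)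
  betti_zero : betti 0 = 1
  deg_zero : ∀ j, deg 0 j = 0
  homogeneous : ∀ i j k s, MvPolynomial.coeff s (diff i j k) ≠ 0 →
    Finsupp.weight d s + deg i j = deg (i + 1) k
  minimal : ∀ i j k, MvPolynomial.constantCoeff (diff i j k) = 0
  exact_zero : ∀ v : Fin (betti 0) → MvPolynomial (Fin m) K,
    (∀ j, v j ∈ toricIdeal K d) ↔ ∃ w, (diff 0).mulVec w = v
  exact_succ : ∀ i, ∀ v : Fin (betti (i + 1)) → MvPolynomial (Fin m) K,
    (diff i).mulVec v = 0 ↔ ∃ w, (diff (i + 1)).mulVec w = v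

variable {K : Type*} [Field K] {m : ℕ} {d : Fin m → ℕ}

/-- The multiset `𝔅_i` of the degrees `C_{j,i}`, `1 ≤ j ≤ β_i`. -/
def syz (r : MinimalResolution K d) (i : ℕ) : Multiset ℤ :=
  (Finset.univ : Finset (Fin (r.betti i))).val.map fun j => (r.deg i j : ℤ)

/-- The multiset of the conjugate degrees `F + Σ_m - C_{j,i}`, `1 ≤ j ≤ β_i`. -/
noncomputable def syzBar (r : MinimalResolution K d) (i : ℕ) : Multiset ℤ :=
  (Finset.univ : Finset (Fin (r.betti i))).val.map fun j => -(r.deg i j : ℤ) + frob d + sumGen d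

/-- `𝔅_o`: the join of the `𝔅_i` with `1 ≤ i ≤ m - 2`, `i` odd. -/
def syzOdd (r : MinimalResolution K d) : Multiset ℤ :=
  ∑ i ∈ (Finset.Icc 1 (m - 2)).filter (fun i => Odd i), syz r i

/-- `𝔅_e`: the join of the `𝔅_i` with `1 ≤ i ≤ m - 2`, `i` even. -/
def syzEven (r : MinimalResolution K d) : Multiset ℤ :=
  ∑ i ∈ (Finset.Icc 1 (m - 2)).filter (fun i => Even i), syz r i

/-- The join of the conjugates of the `𝔅_i` with `1 ≤ i ≤ m - 2`, `i` odd. -/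
noncomputable def syzBarOdd (r : MinimalResolution K d) : Multiset ℤ :=
  ∑ i ∈ (Finset.Icc 1 (m - 2)).filter (fun i => Odd i), syzBar r i

/-- The join of the conjugates of the `𝔅_i` with `1 ≤ i ≤ m - 2`, `i` even. -/
noncomputable def syzBarEven (r : MinimalResolution K d) : Multiset ℤ :=
  ∑ i ∈ (Finset.Icc 1 (m - 2)).filter (fun i => Even i), syzBar r i

/-- The multiset `𝔛₁`; it is composed differently for even and odd `m`. -/
noncomputable def syzX1 (r : MinimalResolution K d) : Multiset ℤ :=
  if Even m then syzOdd r + syzBarOdd r else syzOdd r + syzBarEven r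

/-- The multiset `𝔛₂`; it is composed differently for even and odd `m`. -/
noncomputable def syzX2 (r : MinimalResolution K d) : Multiset ℤ :=
  if Even m then syzEven r + syzBarEven r else syzEven r + syzBarOdd r

/-- `℘`, the cardinality of `𝔛₁₂ = 𝔛₁ ⋀ 𝔛₂` (multiplicities are minima). -/
noncomputable def wp (r : MinimalResolution K d) : ℕ := Multiset.card (syzX1 r ∩ syzX2 r)

/-- `δ = ℘ - ℓ`. -/
noncomputable def delta (r : MinimalResolution K d) : ℤ := (wp r : ℤ) - (ell d : ℤ)

end Resolution

end NumSgp

/-! The number of syzygies of homological degree `i` and degree `c` is the dimension of the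
degree-`c` part of `Tor_i(k[S], k)`, which is computed by the Koszul complex of `k[S]`
(`card_deg_eq_hdim`). In degree `c` this complex is the chain complex of the simplicial complex of
all `I` with `c - ∑_{j ∈ I} d_j ∈ S`. The rest is counting of subsets and ranks.

Euler characteristic: exactly one of `x ∈ S`, `F - x ∈ S`, `x ∈ Δ_H` holds. Applied to `x = c - ∑_{j
∈ I} d_j` and summed over `I` with sign `(-1)^#I`, this relates syzygy degrees, their conjugates and
the sums of generators and gaps (`alternating_sum_syzCount_add`). The last syzygy degrees are `f +
Σ_m` with `f ∈ S'`; almost symmetry gives `S' = {F} ∪ Δ_H`, so all extreme terms cancel and `𝔛₂ +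
𝔏_e = 𝔛₁ + 𝔏_o` (`syzX2_add_genGapEven`). Comparing minima of multiplicities gives `δ = #𝔛₁ - #𝔏_e`,
that is, `δ = ∑_{1 ≤ i ≤ m-2} β_i - γ (2^(m-1) - 1)` (`two_mul_delta`).

Total Betti number: the homology has dimension the number of faces minus twice the ranks of the
differentials. These are injective on chains supported on faces through a fixed vertex `t`. What
remains after cancellation is indexed by sets `I` not containing `t` and Apéry elements of `S` with
respect to `d_t`, at most `d_t * 2^(m-1)` in all. In each degree `d_j`, `j ≠ t`, the rank is larger
by one, which saves a further `2 (m - 1)` (`sum_betti_add_le`). Taking for `d_t` the smallest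
generator and inserting `β_0 = 1`, `β_{m-1} = γ + 1` gives the bound. -/

namespace NumSgp

/-! ### Koszul complexes of commuting operators on graded spaces. -/

section Koszul

open Finset

variable {k : Type*} [Field k] {n : ℕ} {A B : Type*} [AddCommGroup A] [Module k A]
  [AddCommGroup B] [Module k B]

/-- The sign `(-1) ^ #{j ∈ I | j < i}` of the exterior multiplication by `e_i`. -/
def sgn (k : Type*) [Field k] {n : ℕ} (i : Fin n) (I : Finset (Fin n)) : k :=
  (-1) ^ #{j ∈ I | j < i}

theorem sgn_mul_self (i : Fin n) (I : Finset (Fin n)) : sgn k i I * sgn k i I = 1 := by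
  rw [sgn, ← mul_pow]; simp

theorem sgn_ne_zero (i : Fin n) (I : Finset (Fin n)) : sgn k i I ≠ 0 := by
  intro h
  simpa [h] using sgn_mul_self (k := k) i I

theorem sgn_insert_self (i : Fin n) (I : Finset (Fin n)) : sgn k i (insert i I) = sgn k i I := by
  simp [sgn, filter_insert]

theorem sgn_insert_of_lt {i j : Fin n} {I : Finset (Fin n)} (hj : j ∉ I) (h : j < i) :
    sgn k i (insert j I) = -sgn k i I := by
  rw [sgn, sgn, filter_insert, if_pos h, card_insert_of_notMem (by simp [hj]), pow_succ]
  ring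

theorem sgn_insert_of_not_lt {i j : Fin n} {I : Finset (Fin n)} (h : ¬ j < i) :
    sgn k i (insert j I) = sgn k i I := by
  rw [sgn, sgn, filter_insert, if_neg h]

theorem sgn_insert_mul {i j : Fin n} {I : Finset (Fin n)} (hij : i ≠ j) (hi : i ∉ I)
    (hj : j ∉ I) :
    sgn k i I * sgn k j (insert i I) = -(sgn k j I * sgn k i (insert j I)) := by
  rcases lt_or_gt_of_ne hij with h | h
  · rw [sgn_insert_of_lt hi h, sgn_insert_of_not_lt h.asymm]; ring
  · rw [sgn_insert_of_lt hj h, sgn_insert_of_not_lt h.asymm]; ring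

/-- Contraction with the dual basis vector of `e_i` on the exterior algebra with coefficients in
`A`; a chain is the family of its coefficients with respect to the basis vectors `e_I`. -/
def contr (k : Type*) [Field k] {n : ℕ} (A : Type*) [AddCommGroup A] [Module k A] (i : Fin n) :
    (Finset (Fin n) → A) →ₗ[k] (Finset (Fin n) → A) where
  toFun u I := if i ∈ I then 0 else sgn k i I • u (insert i I)
  map_add' u v := by
    ext I
    by_cases h : i ∈ I <;> simp [h]
  map_smul' a u := by
    ext I
    by_cases h : i ∈ I <;> simp [h, smul_comm a]

/-- Exterior multiplication by `e_i`. -/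
def wedge (k : Type*) [Field k] {n : ℕ} (A : Type*) [AddCommGroup A] [Module k A] (i : Fin n) :
    (Finset (Fin n) → A) →ₗ[k] (Finset (Fin n) → A) where
  toFun u I := if i ∈ I then sgn k i I • u (I.erase i) else 0
  map_add' u v := by
    ext I
    by_cases h : i ∈ I <;> simp [h]
  map_smul' a u := by
    ext I
    by_cases h : i ∈ I <;> simp [h, smul_comm a]

theorem contr_apply (i : Fin n) (u : Finset (Fin n) → A) (I : Finset (Fin n)) :
    contr k A i u I = if i ∈ I then 0 else sgn k i I • u (insert i I) := rfl

theorem wedge_apply (i : Fin n) (u : Finset (Fin n) → A) (I : Finset (Fin n)) :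
    wedge k A i u I = if i ∈ I then sgn k i I • u (I.erase i) else 0 := rfl

theorem contr_contr (i j : Fin n) (u : Finset (Fin n) → A) :
    contr k A i (contr k A j u) = -contr k A j (contr k A i u) := by
  ext I
  by_cases hij : i = j
  · subst hij
    simp [contr_apply]
  by_cases hi : i ∈ I
  · simp [contr_apply, hi]
  by_cases hj : j ∈ I
  · simp [contr_apply, hj]
  simp only [contr_apply, hi, hj, if_false, mem_insert, hij, Ne.symm hij, or_self, Pi.neg_apply,
    smul_smul, sgn_insert_mul hij hi hj, insert_comm i j, neg_smul]

theorem contr_wedge_self (i : Fin n) (u : Finset (Fin n) → A) :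
    contr k A i (wedge k A i u) + wedge k A i (contr k A i u) = u := by
  ext I
  by_cases hi : i ∈ I
  · have h1 : sgn k i I = sgn k i (I.erase i) := by
      conv_lhs => rw [← insert_erase hi, sgn_insert_self]
    simp [contr_apply, wedge_apply, hi, smul_smul, h1, sgn_mul_self]
  · simp [contr_apply, wedge_apply, hi, smul_smul, sgn_insert_self, sgn_mul_self]

theorem contr_wedge_of_ne {i j : Fin n} (hij : i ≠ j) (u : Finset (Fin n) → A) :
    contr k A i (wedge k A j u) + wedge k A j (contr k A i u) = 0 := by
  ext I
  by_cases hi : i ∈ I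
  · simp [contr_apply, wedge_apply, hi, hij]
  by_cases hj : j ∈ I
  · obtain ⟨J, hJ, rfl⟩ : ∃ J, j ∉ J ∧ insert j J = I := ⟨I.erase j, by simp, insert_erase hj⟩
    have hiJ : i ∉ J := fun h => hi (mem_insert_of_mem h)
    have e1 : (insert i (insert j J)).erase j = insert i J := by
      rw [insert_comm, erase_insert]; simp [hJ, Ne.symm hij]
    have e2 : sgn k i (insert j J) * sgn k j (insert i (insert j J)) =
        -(sgn k j (insert j J) * sgn k i J) := by
      rw [insert_comm, sgn_insert_self, sgn_insert_self]
      rcases lt_or_gt_of_ne hij with h | h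
      · rw [sgn_insert_of_lt hiJ h, sgn_insert_of_not_lt h.asymm]; ring
      · rw [sgn_insert_of_lt hJ h, sgn_insert_of_not_lt h.asymm]; ring
    simp only [contr_apply, wedge_apply, hi, if_false, mem_insert_self, if_true, mem_insert,
      or_true, e1, erase_insert hJ, hiJ, smul_smul, Pi.add_apply, Pi.zero_apply, e2]
    module
  · simp [contr_apply, wedge_apply, hi, hj, Ne.symm hij]

theorem wedge_contr_self (i : Fin n) (u : Finset (Fin n) → A) (I : Finset (Fin n)) :
    wedge k A i (contr k A i u) I = if i ∈ I then u I else 0 := by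
  by_cases hi : i ∈ I
  · have h1 : sgn k i I = sgn k i (I.erase i) := by
      conv_lhs => rw [← insert_erase hi, sgn_insert_self]
    simp [contr_apply, wedge_apply, hi, smul_smul, h1, sgn_mul_self]
  · simp [wedge_apply, hi]

/-- The linear map induced on chains by a linear map of coefficients. -/
abbrev onCoeff (n : ℕ) (f : A →ₗ[k] B) : (Finset (Fin n) → A) →ₗ[k] (Finset (Fin n) → B) :=
  f.compLeft (Finset (Fin n))

theorem onCoeff_contr (f : A →ₗ[k] B) (i : Fin n) (u : Finset (Fin n) → A) :
    onCoeff n f (contr k A i u) = contr k B i (onCoeff n f u) := by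
  ext I
  by_cases hi : i ∈ I <;> simp [contr_apply, hi]

theorem onCoeff_wedge (f : A →ₗ[k] B) (i : Fin n) (u : Finset (Fin n) → A) :
    onCoeff n f (wedge k A i u) = wedge k B i (onCoeff n f u) := by
  ext I
  by_cases hi : i ∈ I <;> simp [wedge_apply, hi]

/-- The differential of the Koszul complex of the operators `x_i` on `A`. -/
def bdry (x : Fin n → Module.End k A) : (Finset (Fin n) → A) →ₗ[k] (Finset (Fin n) → A) :=
  ∑ i, contr k A i ∘ₗ onCoeff n (x i)

theorem bdry_eq (x : Fin n → Module.End k A) (u : Finset (Fin n) → A) :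
    bdry x u = ∑ i, contr k A i (onCoeff n (x i) u) := by
  simp [bdry]

theorem bdry_apply (x : Fin n → Module.End k A) (u : Finset (Fin n) → A) (I : Finset (Fin n)) :
    bdry x u I = ∑ i, if i ∈ I then 0 else sgn k i I • x i (u (insert i I)) := by
  simp [bdry, contr_apply]

theorem onCoeff_bdry {x : Fin n → Module.End k A} {y : Fin n → Module.End k B} {f : A →ₗ[k] B}
    (hf : ∀ i a, f (x i a) = y i (f a)) (u : Finset (Fin n) → A) :
    onCoeff n f (bdry x u) = bdry y (onCoeff n f u) := by
  rw [bdry_eq, bdry_eq, map_sum]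
  refine sum_congr rfl fun i _ => ?_
  rw [onCoeff_contr]
  congr 1
  ext I
  simp [hf]

theorem bdry_bdry [CharZero k] {x : Fin n → Module.End k A}
    (hx : ∀ i j a, x i (x j a) = x j (x i a)) (u : Finset (Fin n) → A) :
    bdry x (bdry x u) = 0 := by
  have e : ∀ i j, contr k A i (onCoeff n (x i) (contr k A j (onCoeff n (x j) u))) =
      -contr k A j (onCoeff n (x j) (contr k A i (onCoeff n (x i) u))) := by
    intro i j
    rw [onCoeff_contr, onCoeff_contr, contr_contr]
    congr 3
    ext I
    simp [hx i j]
  have h1 : bdry x (bdry x u) =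
      ∑ i, ∑ j, contr k A i (onCoeff n (x i) (contr k A j (onCoeff n (x j) u))) := by
    rw [bdry_eq]
    refine sum_congr rfl fun i _ => ?_
    rw [bdry_eq, map_sum, map_sum]
  -- Antisymmetry of the double sum only yields `2 ∂² = 0`; the characteristic does the rest.
  have h2 : bdry x (bdry x u) = -bdry x (bdry x u) := by
    conv_rhs => rw [h1, sum_comm]
    rw [h1, ← sum_neg_distrib]
    refine sum_congr rfl fun i _ => ?_
    rw [← sum_neg_distrib]
    exact sum_congr rfl fun j _ => e i j
  have h3 : (2 : k) • bdry x (bdry x u) = 0 := by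
    rw [two_smul]
    nth_rewrite 1 [h2]
    simp
  exact (smul_eq_zero.mp h3).resolve_left two_ne_zero

/-- The sum of the degrees of the `e_i`, `i ∈ I`. -/
def degSum (d : Fin n → ℕ) (I : Finset (Fin n)) : ℤ := ∑ j ∈ I, (d j : ℤ)

theorem degSum_insert (d : Fin n → ℕ) {i : Fin n} {I : Finset (Fin n)} (h : i ∉ I) :
    degSum d (insert i I) = d i + degSum d I := sum_insert h

/-- The `i`-chains of degree `c` of the Koszul complex, for a graded module with components
`G a`. -/
def chains (d : Fin n → ℕ) (G : ℤ → Submodule k A) (i : ℕ) (c : ℤ) :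
    Submodule k (Finset (Fin n) → A) where
  carrier := {u | ∀ I, u I ∈ G (c - degSum d I) ∧ (#I ≠ i → u I = 0)}
  add_mem' hu hv I := ⟨add_mem (hu I).1 (hv I).1, fun h => by simp [(hu I).2 h, (hv I).2 h]⟩
  zero_mem' I := ⟨zero_mem _, fun _ => rfl⟩
  smul_mem' a u hu I := ⟨Submodule.smul_mem _ _ (hu I).1, fun h => by simp [(hu I).2 h]⟩

/-- The operators `x_i` have degree `d_i`. -/
def RespectsDeg (d : Fin n → ℕ) (x : Fin n → Module.End k A) (G : ℤ → Submodule k A) : Prop :=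
  ∀ i a v, v ∈ G a → x i v ∈ G (a + d i)

theorem bdry_mem_chains {d : Fin n → ℕ} {x : Fin n → Module.End k A} {G : ℤ → Submodule k A}
    (hG : RespectsDeg d x G) {i : ℕ} {c : ℤ} {u : Finset (Fin n) → A}
    (hu : u ∈ chains d G (i + 1) c) : bdry x u ∈ chains d G i c := by
  intro I
  rw [bdry_apply]
  constructor
  · refine sum_mem fun j _ => ?_
    split_ifs with h
    · exact zero_mem _
    · refine Submodule.smul_mem _ _ ?_
      have := hG j _ _ (hu (insert j I)).1
      rw [degSum_insert d h] at this
      convert this using 2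
      ring
  · intro hI
    refine sum_eq_zero fun j _ => ?_
    split_ifs with h
    · rfl
    · rw [(hu (insert j I)).2 (by rw [card_insert_of_notMem h]; omega)]
      simp

theorem bdry_eq_zero_of_mem_chains_zero {d : Fin n → ℕ} (x : Fin n → Module.End k A)
    {G : ℤ → Submodule k A} {c : ℤ} {u : Finset (Fin n) → A} (hu : u ∈ chains d G 0 c) :
    bdry x u = 0 := by
  ext I
  rw [bdry_apply]
  refine sum_eq_zero fun j _ => ?_
  split_ifs with h
  · rfl
  · rw [(hu (insert j I)).2 (by rw [card_insert_of_notMem h]; omega)]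
    simp

/-- The cycles of degree `c`. -/
def cyc (d : Fin n → ℕ) (x : Fin n → Module.End k A) (G : ℤ → Submodule k A) (i : ℕ) (c : ℤ) :
    Submodule k (Finset (Fin n) → A) :=
  chains d G i c ⊓ LinearMap.ker (bdry x)

/-- The boundaries of degree `c`. -/
def bds (d : Fin n → ℕ) (x : Fin n → Module.End k A) (G : ℤ → Submodule k A) (i : ℕ) (c : ℤ) :
    Submodule k (Finset (Fin n) → A) :=
  (chains d G (i + 1) c).map (bdry x)

/-- The dimension of the Koszul homology in degree `c`. -/
noncomputable def hdim (d : Fin n → ℕ) (x : Fin n → Module.End k A) (G : ℤ → Submodule k A)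
    (i : ℕ) (c : ℤ) : ℕ :=
  Module.finrank k (cyc d x G i c ⧸ (bds d x G i c).submoduleOf (cyc d x G i c))

theorem finrank_quotient_of_map_eq {V V' : Type*} [AddCommGroup V] [Module k V]
    [AddCommGroup V'] [Module k V'] (f : V →ₗ[k] V') {W : Submodule k V} {Z C : Submodule k V'}
    (hZ : W.map f = Z) :
    Module.finrank k (W ⧸ (C.comap f).submoduleOf W) =
      Module.finrank k (Z ⧸ C.submoduleOf Z) := by
  let q : W →ₗ[k] (Z ⧸ C.submoduleOf Z) :=
    (C.submoduleOf Z).mkQ ∘ₗ (f.restrict (p := W) (q := Z)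
      (fun w hw => hZ ▸ Submodule.mem_map_of_mem hw))
  have hq : Function.Surjective q := by
    intro z
    obtain ⟨⟨z, hz⟩, rfl⟩ := Submodule.mkQ_surjective _ z
    obtain ⟨w, hw, rfl⟩ : z ∈ W.map f := hZ ▸ hz
    exact ⟨⟨w, hw⟩, rfl⟩
  have hk : LinearMap.ker q = (C.comap f).submoduleOf W := by
    ext w
    rw [LinearMap.ker_comp, Submodule.ker_mkQ]
    rfl
  exact ((Submodule.quotEquivOfEq _ _ hk.symm).trans
    (q.quotKerEquivOfSurjective hq)).finrank_eq

/-- Both quotients are the same quotient of `W`. This compares them without a map from one to the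
other, so no connecting homomorphism has to be constructed. -/
theorem finrank_quotient_eq_of_surjective {V V₁ V₂ : Type*} [AddCommGroup V] [Module k V]
    [AddCommGroup V₁] [Module k V₁] [AddCommGroup V₂] [Module k V₂] (f : V →ₗ[k] V₁)
    (g : V →ₗ[k] V₂) (W : Submodule k V) {Z₁ C₁ : Submodule k V₁} {Z₂ C₂ : Submodule k V₂}
    (hf : W.map f = Z₁) (hg : W.map g = Z₂) (h : ∀ w ∈ W, f w ∈ C₁ ↔ g w ∈ C₂) :
    Module.finrank k (Z₁ ⧸ C₁.submoduleOf Z₁) = Module.finrank k (Z₂ ⧸ C₂.submoduleOf Z₂) := by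
  have e : (C₁.comap f).submoduleOf W = (C₂.comap g).submoduleOf W := by
    ext ⟨w, hw⟩
    exact h w hw
  rw [← finrank_quotient_of_map_eq f hf, ← finrank_quotient_of_map_eq g hg, e]

theorem map_onCoeff_chains (d : Fin n → ℕ) (G : ℤ → Submodule k A) (f : A →ₗ[k] B) (i : ℕ)
    (c : ℤ) : (chains d G i c).map (onCoeff n f) = chains d (fun a => (G a).map f) i c := by
  ext z
  constructor
  · rintro ⟨u, hu, rfl⟩ I
    exact ⟨Submodule.mem_map_of_mem (hu I).1, fun h => by simp [(hu I).2 h]⟩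
  · intro hz
    have : ∀ I, ∃ a, a ∈ G (c - degSum d I) ∧ (#I ≠ i → a = 0) ∧ f a = z I := by
      intro I
      by_cases h : #I = i
      · obtain ⟨a, ha, h'⟩ := (hz I).1
        exact ⟨a, ha, fun h'' => absurd h h'', h'⟩
      · exact ⟨0, zero_mem _, fun _ => rfl, by rw [(hz I).2 h, map_zero]⟩
    choose u h1 h2 h3 using this
    exact ⟨u, fun I => ⟨h1 I, h2 I⟩, funext h3⟩

/-- Dimension shift in the long exact sequence of `0 → ker f → G → f(G) → 0`: `h2` says that
`H_{j+1}(G)` vanishes, `h1` that `H_j(ker f) → H_j(G)` is zero. The common cover consists of the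
chains of `G` whose boundary has coefficients in `ker f`; `f` maps it onto the cycles of `f(G)`, and
the boundary maps it onto those of `ker f`. -/
theorem hdim_map_succ [CharZero k] {d : Fin n → ℕ} {x : Fin n → Module.End k A}
    {y : Fin n → Module.End k B} {G : ℤ → Submodule k A} {f : A →ₗ[k] B}
    (hx : ∀ i j a, x i (x j a) = x j (x i a)) (hf : ∀ i a, f (x i a) = y i (f a))
    (hG : RespectsDeg d x G) {j : ℕ} {c : ℤ}
    (h1 : cyc d x (fun a => G a ⊓ LinearMap.ker f) j c ≤ bds d x G j c)
    (h2 : cyc d x G (j + 1) c ≤ bds d x G (j + 1) c) :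
    hdim d y (fun a => (G a).map f) (j + 1) c =
      hdim d x (fun a => G a ⊓ LinearMap.ker f) j c := by
  have ker_iff : ∀ i (u : Finset (Fin n) → A), u ∈ chains d (fun a => G a ⊓ LinearMap.ker f) i c ↔
      u ∈ chains d G i c ∧ onCoeff n f u = 0 := by
    intro i u
    constructor
    · intro hu
      exact ⟨fun I => ⟨(hu I).1.1, (hu I).2⟩, funext fun I => (hu I).1.2⟩
    · rintro ⟨hu, h0⟩ I
      exact ⟨⟨(hu I).1, congrFun h0 I⟩, (hu I).2⟩
  refine finrank_quotient_eq_of_surjective (onCoeff n f) (bdry x)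
    (chains d G (j + 1) c ⊓ (chains d (fun a => G a ⊓ LinearMap.ker f) j c).comap (bdry x))
    ?_ ?_ ?_
  · ext z
    constructor
    · rintro ⟨u, ⟨hu, hu'⟩, rfl⟩
      refine ⟨?_, ?_⟩
      · rw [← map_onCoeff_chains]
        exact Submodule.mem_map_of_mem hu
      · exact (onCoeff_bdry hf u).symm.trans ((ker_iff _ _).1 hu').2
    · rintro ⟨hz, hz'⟩
      rw [← map_onCoeff_chains] at hz
      obtain ⟨u, hu, rfl⟩ := hz
      refine ⟨u, ⟨hu, (ker_iff _ _).2 ⟨bdry_mem_chains hG hu, ?_⟩⟩, rfl⟩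
      exact (onCoeff_bdry hf u).trans hz'
  · ext z
    constructor
    · rintro ⟨u, ⟨hu, hu'⟩, rfl⟩
      exact ⟨hu', bdry_bdry hx u⟩
    · intro hz
      obtain ⟨u, hu, rfl⟩ := h1 hz
      exact ⟨u, ⟨hu, hz.1⟩, rfl⟩
  · rintro u ⟨hu, hu'⟩
    constructor
    · rintro ⟨w, hw, hwu⟩
      rw [← map_onCoeff_chains] at hw
      obtain ⟨w, hw, rfl⟩ := hw
      refine ⟨u - bdry x w, (ker_iff _ _).2 ⟨sub_mem hu (bdry_mem_chains hG hw), ?_⟩, ?_⟩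
      · rw [map_sub, onCoeff_bdry hf, hwu, sub_self]
      · rw [map_sub, bdry_bdry hx, sub_zero]
    · rintro ⟨v, hv, hvu⟩
      rw [SetLike.mem_coe, ker_iff] at hv
      obtain ⟨w, hw, hwu⟩ := h2 (show u - v ∈ cyc d x G (j + 1) c from
        ⟨sub_mem hu hv.1, LinearMap.mem_ker.2 (by rw [map_sub, hvu, sub_self])⟩)
      refine ⟨onCoeff n f w, ?_, ?_⟩
      · rw [← map_onCoeff_chains]
        exact Submodule.mem_map_of_mem hw
      · rw [← onCoeff_bdry hf, hwu, map_sub, hv.2, sub_zero]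

end Koszul

/-! ### Acyclicity of the Koszul complex of a graded free module. -/

section Free

open Finset MvPolynomial

variable {K : Type*} [Field K] {m : ℕ}

/-- Weighted de Rham operator against Koszul differential. Mixed terms cancel because contraction
and wedge with different indices anticommute; the diagonal terms give `x_j D_j`, and the commutator
`[D_j, x_j] = 1` contributes the wedge-contraction term. -/
theorem bdry_homotopy {A : Type*} [AddCommGroup A] [Module K A] {x D : Fin m → Module.End K A}
    (hD : ∀ i j v, D j (x i v) = x i (D j v) + if i = j then v else 0) (a : Fin m → K)
    (u : Finset (Fin m) → A) :
    bdry x (∑ j, a j • wedge K A j (onCoeff m (D j) u)) +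
      ∑ j, a j • wedge K A j (onCoeff m (D j) (bdry x u)) =
    ∑ j, a j • (onCoeff m (x j) (onCoeff m (D j) u) + wedge K A j (contr K A j u)) := by
  rw [map_sum, ← sum_add_distrib]
  refine sum_congr rfl fun j _ => ?_
  rw [map_smul, ← smul_add, bdry_eq, bdry_eq, map_sum, map_sum, ← sum_add_distrib,
    sum_eq_single j]
  · congr 1
    have e : onCoeff m (D j) (onCoeff m (x j) u) = onCoeff m (x j) (onCoeff m (D j) u) + u := by
      ext I
      simp [hD]
    rw [onCoeff_wedge, onCoeff_contr, e, map_add, map_add, ← add_assoc, contr_wedge_self]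
  · intro i _ hij
    have e : onCoeff m (D j) (onCoeff m (x i) u) = onCoeff m (x i) (onCoeff m (D j) u) := by
      ext I
      simp [hD, hij]
    rw [onCoeff_wedge, onCoeff_contr, e, contr_wedge_of_ne hij]
  · simp

/-- Multiplication by `X_i` on a free module. -/
noncomputable def mulX (K : Type*) [Field K] {m : ℕ} (b : ℕ) (i : Fin m) :
    Module.End K (Fin b → MvPolynomial (Fin m) K) :=
  (LinearMap.mulLeft K (X i : MvPolynomial (Fin m) K)).compLeft (Fin b)

theorem mulX_apply (b : ℕ) (i : Fin m) (v : Fin b → MvPolynomial (Fin m) K) (l : Fin b) :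
    mulX K b i v l = X i * v l := rfl

theorem mulX_comm (b : ℕ) (i j : Fin m) (v : Fin b → MvPolynomial (Fin m) K) :
    mulX K b i (mulX K b j v) = mulX K b j (mulX K b i v) := by
  ext1 l
  simp only [mulX_apply]
  ring

/-- The partial derivative with respect to `X_i` on a free module. -/
noncomputable def pderivEnd (K : Type*) [Field K] {m : ℕ} (b : ℕ) (i : Fin m) :
    Module.End K (Fin b → MvPolynomial (Fin m) K) :=
  (pderiv i : Derivation K (MvPolynomial (Fin m) K) _).toLinearMap.compLeft (Fin b)

theorem pderivEnd_apply (b : ℕ) (i : Fin m) (v : Fin b → MvPolynomial (Fin m) K) (l : Fin b) :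
    pderivEnd K b i v l = pderiv i (v l) := rfl

/-- The component of degree `c` of the free module `⨁_j P(-e_j)`. -/
def freeDeg (K : Type*) [Field K] {m : ℕ} (d : Fin m → ℕ) {b : ℕ} (e : Fin b → ℕ) (c : ℤ) :
    Submodule K (Fin b → MvPolynomial (Fin m) K) where
  carrier := {v | ∀ l s, coeff s (v l) ≠ 0 → (Finsupp.weight d s : ℤ) + e l = c}
  add_mem' {v w} hv hw l s h := by
    by_contra hne
    have h1 : coeff s (v l) = 0 := not_not.1 fun h' => hne (hv l s h')
    have h2 : coeff s (w l) = 0 := not_not.1 fun h' => hne (hw l s h')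
    exact h (by simp [h1, h2])
  zero_mem' l s h := absurd (by simp) h
  smul_mem' a v hv l s h := hv l s fun h' => h (by simp [h'])

theorem respectsDeg_mulX (d : Fin m → ℕ) {b : ℕ} (e : Fin b → ℕ) :
    RespectsDeg d (mulX K b) (freeDeg K d e) := by
  intro i a v hv l s h
  rw [mulX_apply, mul_comm, coeff_mul_X'] at h
  split_ifs at h with hs
  · have h1 := hv l _ h
    have h2 : s = (s - Finsupp.single i 1) + Finsupp.single i 1 := by
      rw [tsub_add_cancel_of_le]
      simpa [Nat.one_le_iff_ne_zero] using hs
    rw [h2, map_add, Finsupp.weight_single]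
    push_cast
    simp only [smul_eq_mul, one_mul]
    linarith
  · exact absurd rfl h

theorem pderivEnd_mem_freeDeg {d : Fin m → ℕ} {b : ℕ} {e : Fin b → ℕ} {c : ℤ}
    {v : Fin b → MvPolynomial (Fin m) K} (hv : v ∈ freeDeg K d e c) (i : Fin m) :
    pderivEnd K b i v ∈ freeDeg K d e (c - d i) := by
  intro l s h
  rw [pderivEnd_apply, coeff_pderiv] at h
  have h1 := hv l _ (left_ne_zero_of_mul h)
  rw [map_add, Finsupp.weight_single] at h1
  push_cast at h1
  simp only [smul_eq_mul, one_mul] at h1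
  linarith

theorem euler_freeDeg {d : Fin m → ℕ} {b : ℕ} {e : Fin b → ℕ} {c : ℤ}
    {v : Fin b → MvPolynomial (Fin m) K} (hv : v ∈ freeDeg K d e c) (l : Fin b) :
    ∑ i, (d i : K) • (X i * pderiv i (v l)) = ((c - e l : ℤ) : K) • v l := by
  by_cases h0 : v l = 0
  · simp [h0]
  obtain ⟨s, hs⟩ := ne_zero_iff.1 h0
  have hw : IsWeightedHomogeneous d (v l) (Finsupp.weight d s) := by
    intro t ht
    have h1 := hv l t ht
    have h2 := hv l s hs
    zify
    linarith
  have hc : c - e l = (Finsupp.weight d s : ℕ) := by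
    have h2 := hv l s hs
    linarith
  rw [hc, Int.cast_natCast, Nat.cast_smul_eq_nsmul, ← hw.sum_weight_X_mul_pderiv]
  exact sum_congr rfl fun i _ => Nat.cast_smul_eq_nsmul _ _ _

theorem degSum_nonneg (d : Fin m → ℕ) (I : Finset (Fin m)) : 0 ≤ degSum d I :=
  sum_nonneg fun _ _ => Int.natCast_nonneg _

theorem degSum_eq_zero_iff {d : Fin m → ℕ} (hd : ∀ i, 0 < d i) {I : Finset (Fin m)} :
    degSum d I = 0 ↔ I = ∅ := by
  constructor
  · intro h
    by_contra hne
    obtain ⟨i, hi⟩ := nonempty_iff_ne_empty.2 hne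
    have := (sum_eq_zero_iff_of_nonneg (fun _ _ => Int.natCast_nonneg _)).1 h i hi
    have := hd i
    omega
  · rintro rfl
    simp [degSum]

/-- With weights `d_j` the homotopy acts on the coefficient `u I l` as a scalar: Euler's formula
gives `c - degSum d I - e l`, the wedge-contraction term gives `degSum d I`, in total `c - e l`.
Where this is nonzero one divides by it. Where it is zero, only a constant at `I = ∅` could survive,
and `h0` excludes it. -/
theorem mem_bds_freeDeg [CharZero K] {d : Fin m → ℕ} (hd : ∀ i, 0 < d i) {b : ℕ} (e : Fin b → ℕ)
    {i : ℕ} {c : ℤ} {u : Finset (Fin m) → Fin b → MvPolynomial (Fin m) K}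
    (hu : u ∈ cyc d (mulX K b) (freeDeg K d e) i c)
    (h0 : ∀ l, constantCoeff (u ∅ l) = 0) :
    u ∈ bds d (mulX K b) (freeDeg K d e) i c := by
  obtain ⟨hu, hker⟩ := hu
  rw [SetLike.mem_coe, LinearMap.mem_ker] at hker
  set h := ∑ j, (d j : K) • wedge K _ j (onCoeff m (pderivEnd K b j) u) with hdef
  have hD : ∀ (i j : Fin m) (v : Fin b → MvPolynomial (Fin m) K),
      pderivEnd K b j (mulX K b i v) =
        mulX K b i (pderivEnd K b j v) + if i = j then v else 0 := by
    intro i j v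
    ext1 l
    rw [pderivEnd_apply, mulX_apply, pderiv_mul, Pi.add_apply, mulX_apply, pderivEnd_apply]
    by_cases hij : i = j
    · subst hij
      rw [pderiv_X_self, if_pos rfl]
      ring
    · rw [pderiv_X_of_ne hij, if_neg hij]
      simp
  have hh : ∀ I l, bdry (mulX K b) h I l = ((c - e l : ℤ) : K) • u I l := by
    intro I l
    have := bdry_homotopy hD (fun j => (d j : K)) u
    simp only [hker, map_zero, smul_zero, sum_const_zero, add_zero] at this
    rw [hdef, this]
    simp only [smul_add, sum_add_distrib, Pi.add_apply, Finset.sum_apply, Pi.smul_apply,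
      LinearMap.compLeft_apply, Function.comp_apply, mulX_apply, pderivEnd_apply, wedge_contr_self]
    rw [euler_freeDeg (hu I).1]
    have : ∀ j : Fin m, (d j : K) • (if j ∈ I then u I else 0) l =
        (if j ∈ I then (d j : K) else 0) • u I l := by
      intro j
      split_ifs <;> simp
    simp only [this]
    rw [← Finset.sum_smul, ← add_smul, ← Finset.sum_filter, Finset.filter_univ_mem]
    congr 1
    simp only [degSum]
    push_cast
    ring
  -- Since `0⁻¹ = 0`, coordinates with `c = e l` are sent to `0`, which agrees with `u` there.
  let scale : Module.End K (Fin b → MvPolynomial (Fin m) K) :=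
    LinearMap.pi fun l => ((c - e l : ℤ) : K)⁻¹ • LinearMap.proj l
  have hs : ∀ v l, scale v l = ((c - e l : ℤ) : K)⁻¹ • v l := fun v l => rfl
  have hsx : ∀ i v, scale (mulX K b i v) = mulX K b i (scale v) := by
    intro i v
    ext1 l
    simp only [hs, mulX_apply, mul_smul_comm]
  have hsG : ∀ a v, v ∈ freeDeg K d e a → scale v ∈ freeDeg K d e a := by
    intro a v hv l s h
    rw [hs, coeff_smul] at h
    exact hv l s (right_ne_zero_of_smul h)
  refine ⟨onCoeff m scale h, fun I => ⟨hsG _ _ ?_, fun hI => ?_⟩, ?_⟩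
  · rw [hdef, Finset.sum_apply]
    refine sum_mem fun j _ => Submodule.smul_mem _ _ ?_
    rw [wedge_apply]
    split_ifs with hj
    · refine Submodule.smul_mem _ _ ?_
      have := pderivEnd_mem_freeDeg (hu (I.erase j)).1 j
      have e1 : degSum d I = d j + degSum d (I.erase j) := by
        rw [← degSum_insert d (notMem_erase j I), insert_erase hj]
      rwa [sub_sub, add_comm, ← e1] at this
    · exact zero_mem _
  · have : h I = 0 := by
      rw [hdef, Finset.sum_apply]
      refine sum_eq_zero fun j _ => ?_
      rw [Pi.smul_apply, wedge_apply]
      split_ifs with hj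
      · have : #(I.erase j) ≠ i := by
          have := card_erase_add_one hj
          omega
        simp [(hu (I.erase j)).2 this]
      · simp
    simp [this]
  · rw [← onCoeff_bdry hsx]
    ext1 I
    ext1 l
    rw [LinearMap.compLeft_apply, Function.comp_apply, hs, hh]
    by_cases hc : c - e l = 0
    · have : u I l = 0 := by
        by_contra hne
        obtain ⟨s, hs⟩ := ne_zero_iff.1 hne
        have h1 := (hu I).1 l s hs
        have h2 := degSum_nonneg d I
        have h3 : degSum d I = 0 := by omega
        have h4 : Finsupp.weight d s = 0 := by omega
        obtain rfl := (degSum_eq_zero_iff hd).1 h3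
        have h5 : s = 0 := by
          ext t
          by_contra ht
          have := Finsupp.le_weight d (s := t) (hd t).ne' s
          simp at ht
          omega
        subst h5
        exact hs (h0 l)
      simp [this]
    · rw [smul_smul, inv_mul_cancel₀ (by exact_mod_cast hc), one_smul]

end Free

/-! ### Syzygy degrees as Koszul homology of the semigroup ring. -/

section Betti

open Finset MvPolynomial

variable {K : Type*} [Field K] {m : ℕ}

theorem constantCoeff_bdry_mulX {b : ℕ} (w : Finset (Fin m) → Fin b → MvPolynomial (Fin m) K)
    (I : Finset (Fin m)) (l : Fin b) : constantCoeff (bdry (mulX K b) w I l) = 0 := by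
  rw [bdry_apply, Finset.sum_apply, map_sum]
  refine sum_eq_zero fun i _ => ?_
  split_ifs
  · simp
  · rw [Pi.smul_apply, mulX_apply, ← mul_smul_comm, map_mul, constantCoeff_X, zero_mul]

section Cover

variable [CharZero K] {B : Type*} [AddCommGroup B] [Module K B] {d : Fin m → ℕ} {b : ℕ}
  {e : Fin b → ℕ} {y : Fin m → Module.End K B}
  {f : (Fin b → MvPolynomial (Fin m) K) →ₗ[K] B}

theorem hdim_cover_succ (hd : ∀ i, 0 < d i) (hf : ∀ i a, f (mulX K b i a) = y i (f a))
    (hmin : ∀ c, ∀ v ∈ freeDeg K d e c, f v = 0 → ∀ l, constantCoeff (v l) = 0) (j : ℕ) (c : ℤ) :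
    hdim d y (fun a => (freeDeg K d e a).map f) (j + 1) c =
      hdim d (mulX K b) (fun a => freeDeg K d e a ⊓ LinearMap.ker f) j c := by
  refine hdim_map_succ (mulX_comm b) hf (respectsDeg_mulX d e) ?_ ?_
  · intro u hu
    exact mem_bds_freeDeg hd e ⟨fun I => ⟨(hu.1 I).1.1, (hu.1 I).2⟩, hu.2⟩
      (hmin _ _ (hu.1 ∅).1.1 (hu.1 ∅).1.2)
  · intro u hu
    refine mem_bds_freeDeg hd e hu fun l => ?_
    rw [(hu.1 ∅).2 (by simp)]
    simp

/-- A graded Nakayama argument: `H_0` is the image of `f` modulo the operators. By `hmin` no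
relation has a constant term, so the constant terms of the coordinates of degree `c` are well
defined on this quotient and determine its elements. -/
theorem hdim_cover_zero (hd : ∀ i, 0 < d i) (hf : ∀ i a, f (mulX K b i a) = y i (f a))
    (hmin : ∀ c, ∀ v ∈ freeDeg K d e c, f v = 0 → ∀ l, constantCoeff (v l) = 0) (c : ℤ) :
    hdim d y (fun a => (freeDeg K d e a).map f) 0 c = #{l | (e l : ℤ) = c} := by
  let g : (Finset (Fin m) → Fin b → MvPolynomial (Fin m) K) →ₗ[K]
      ({l : Fin b // (e l : ℤ) = c} → K) :=
    LinearMap.pi fun l => (lcoeff K 0) ∘ₗ (LinearMap.proj l.1) ∘ₗ (LinearMap.proj ∅)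
  have hg : ∀ u l, g u l = constantCoeff (u ∅ l.1) := fun u l => rfl
  have h1 := finrank_quotient_eq_of_surjective (onCoeff m f) g (chains d (freeDeg K d e) 0 c)
    (Z₁ := cyc d y (fun a => (freeDeg K d e a).map f) 0 c)
    (C₁ := bds d y (fun a => (freeDeg K d e a).map f) 0 c) (Z₂ := ⊤) (C₂ := ⊥) ?_ ?_ ?_
  · rw [hdim, h1, Submodule.submoduleOf, Submodule.comap_bot, Submodule.ker_subtype,
      (Submodule.quotEquivOfEqBot _ rfl).finrank_eq, finrank_top, Module.finrank_pi,
      Fintype.card_subtype]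
  · rw [map_onCoeff_chains]
    ext z
    exact ⟨fun h => ⟨h, LinearMap.mem_ker.2 (bdry_eq_zero_of_mem_chains_zero y h)⟩, fun h => h.1⟩
  · rw [eq_top_iff]
    rintro z -
    refine ⟨fun I l => if h : I = ∅ ∧ (e l : ℤ) = c then C (z ⟨l, h.2⟩) else 0, ?_, ?_⟩
    · intro I
      constructor
      · intro l s hs
        dsimp only at hs
        split_ifs at hs with h
        · obtain ⟨rfl, h⟩ := h
          rw [coeff_C] at hs
          split_ifs at hs with h'
          · subst h'
            simpa [degSum] using h
          · exact absurd rfl hs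
        · exact absurd (coeff_zero s) hs
      · intro hI
        ext1 l
        have : I ≠ ∅ := by
          rintro rfl
          exact hI rfl
        simp [this]
    · ext l
      rw [hg]
      simp [l.2]
  · intro u hu
    rw [Submodule.mem_bot]
    constructor
    · rintro ⟨w, hw, hwu⟩
      rw [← map_onCoeff_chains] at hw
      obtain ⟨w, hw, rfl⟩ := hw
      have h2 := sub_mem hu (bdry_mem_chains (respectsDeg_mulX d e) hw) ∅
      have h3 : f ((u - bdry (mulX K b) w) ∅) = 0 := by
        have : onCoeff m f (u - bdry (mulX K b) w) = 0 := by
          rw [map_sub, onCoeff_bdry hf, hwu, sub_self]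
        exact congrFun this ∅
      ext l
      have h4 := hmin _ _ h2.1 h3 l.1
      rw [Pi.sub_apply, Pi.sub_apply, map_sub, constantCoeff_bdry_mulX, sub_zero] at h4
      exact h4
    · intro h
      obtain ⟨w, hw, hwu⟩ := mem_bds_freeDeg (K := K) hd e (i := 0)
        ⟨hu, LinearMap.mem_ker.2 (bdry_eq_zero_of_mem_chains_zero _ hu)⟩ (by
          intro l
          by_cases hl : (e l : ℤ) = c
          · exact congrFun h ⟨l, hl⟩
          · by_contra hne
            have := (hu ∅).1 l 0 hne
            simp [degSum] at this
            exact hl this)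
      refine ⟨onCoeff m f w, ?_, ?_⟩
      · rw [← map_onCoeff_chains]
        exact Submodule.mem_map_of_mem hw
      · rw [← onCoeff_bdry hf, hwu]

end Cover

/-- The projection of a free module onto its component of degree `c`. -/
noncomputable def freeProj (d : Fin m → ℕ) {b : ℕ} (e : Fin b → ℕ) (c : ℤ)
    (v : Fin b → MvPolynomial (Fin m) K) : Fin b → MvPolynomial (Fin m) K :=
  fun l => if (e l : ℤ) ≤ c then weightedHomogeneousComponent d (c - e l).toNat (v l) else 0

theorem coeff_freeProj (d : Fin m → ℕ) {b : ℕ} (e : Fin b → ℕ) (c : ℤ)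
    (v : Fin b → MvPolynomial (Fin m) K) (l : Fin b) (s : Fin m →₀ ℕ) :
    coeff s (freeProj d e c v l) =
      if (Finsupp.weight d s : ℤ) + e l = c then coeff s (v l) else 0 := by
  classical
  unfold freeProj
  split_ifs with h1 h2 h2
  · rw [coeff_weightedHomogeneousComponent, if_pos (by omega)]
  · rw [coeff_weightedHomogeneousComponent, if_neg (by omega)]
  · omega
  · simp

theorem freeProj_mem (d : Fin m → ℕ) {b : ℕ} (e : Fin b → ℕ) (c : ℤ)
    (v : Fin b → MvPolynomial (Fin m) K) : freeProj d e c v ∈ freeDeg K d e c := by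
  intro l s h
  rw [coeff_freeProj] at h
  by_contra hne
  exact h (if_neg hne)

theorem freeProj_of_mem {d : Fin m → ℕ} {b : ℕ} {e : Fin b → ℕ} {c : ℤ}
    {v : Fin b → MvPolynomial (Fin m) K} (hv : v ∈ freeDeg K d e c) : freeProj d e c v = v := by
  ext l s
  rw [coeff_freeProj]
  split_ifs with h
  · rfl
  · by_contra hne
    exact h (hv l s (Ne.symm hne))

variable {d : Fin m → ℕ} (r : MinimalResolution K d)

theorem freeProj_mulVec (i : ℕ) (c : ℤ) (w : Fin (r.betti (i + 1)) → MvPolynomial (Fin m) K) :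
    freeProj d (r.deg i) c ((r.diff i).mulVec w) =
      (r.diff i).mulVec (freeProj d (r.deg (i + 1)) c w) := by
  ext l s
  rw [coeff_freeProj]
  simp only [Matrix.mulVec, dotProduct, coeff_sum, coeff_mul, coeff_freeProj]
  have ite_sum : ∀ {ι : Type} (t : Finset ι) (g : ι → K) (p : Prop) [Decidable p],
      (if p then ∑ a ∈ t, g a else 0) = ∑ a ∈ t, if p then g a else 0 := by
    intro ι t g p _
    split_ifs <;> simp
  rw [ite_sum]
  refine sum_congr rfl fun j _ => ?_
  rw [ite_sum]
  refine sum_congr rfl fun p hp => ?_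
  by_cases h0 : coeff p.1 (r.diff i l j) = 0
  · simp [h0]
  · have h1 := r.homogeneous i l j p.1 h0
    have h2 : Finsupp.weight d s = Finsupp.weight d p.1 + Finsupp.weight d p.2 := by
      rw [← mem_antidiagonal.1 hp, map_add]
    have h3 : (Finsupp.weight d s : ℤ) + r.deg i l = c ↔
        (Finsupp.weight d p.2 : ℤ) + r.deg (i + 1) j = c := by
      rw [← h1, h2]
      push_cast
      constructor <;> intro h <;> linarith
    simp only [h3, mul_ite, mul_zero]

/-- The differentials of a resolution as linear maps. -/
noncomputable def diffLin (i : ℕ) : (Fin (r.betti (i + 1)) → MvPolynomial (Fin m) K) →ₗ[K]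
    (Fin (r.betti i) → MvPolynomial (Fin m) K) :=
  (Matrix.mulVecLin (r.diff i)).restrictScalars K

theorem diffLin_apply (i : ℕ) (w : Fin (r.betti (i + 1)) → MvPolynomial (Fin m) K) :
    diffLin r i w = (r.diff i).mulVec w := rfl

theorem diffLin_mulX (i : ℕ) (t : Fin m) (w : Fin (r.betti (i + 1)) → MvPolynomial (Fin m) K) :
    diffLin r i (mulX K _ t w) = mulX K _ t (diffLin r i w) :=
  (Matrix.mulVecLin (r.diff i)).map_smul (X t) w

theorem constantCoeff_diffLin (i : ℕ) (w : Fin (r.betti (i + 1)) → MvPolynomial (Fin m) K)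
    (l : Fin (r.betti i)) : constantCoeff (diffLin r i w l) = 0 := by
  simp [diffLin_apply, Matrix.mulVec, dotProduct, r.minimal]

/-- Exactness of the resolution is stated without degrees; projecting a preimage to degree `c` makes
it homogeneous. The predicate `f` covers both the augmentation and the later differentials. -/
theorem map_diffLin_freeDeg (i : ℕ) (c : ℤ) {f : (Fin (r.betti i) → MvPolynomial (Fin m) K) → Prop}
    (hf : ∀ v ∈ freeDeg K d (r.deg i) c, f v ↔ ∃ w, (r.diff i).mulVec w = v)
    (v : Fin (r.betti i) → MvPolynomial (Fin m) K) :
    v ∈ freeDeg K d (r.deg i) c ∧ f v ↔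
      v ∈ (freeDeg K d (r.deg (i + 1)) c).map (diffLin r i) := by
  constructor
  · rintro ⟨hv, hfv⟩
    obtain ⟨w, rfl⟩ := (hf v hv).1 hfv
    refine ⟨freeProj d _ c w, freeProj_mem _ _ _ _, ?_⟩
    rw [diffLin_apply, ← freeProj_mulVec, freeProj_of_mem hv]
  · rintro ⟨w, hw, rfl⟩
    have : diffLin r i w ∈ freeDeg K d (r.deg i) c := by
      rw [diffLin_apply, ← freeProj_of_mem hw, ← freeProj_mulVec]
      exact freeProj_mem _ _ _ _
    exact ⟨this, (hf _ this).2 ⟨w, rfl⟩⟩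

/-- The augmentation `P → K`, all `X_i ↦ 1`. On the component of degree `c` it has the same kernel
as the map to the semigroup ring. -/
noncomputable def aug : (Fin (r.betti 0) → MvPolynomial (Fin m) K) →ₗ[K] K :=
  ∑ j, (aeval (R := K) fun _ : Fin m => (1 : K)).toLinearMap ∘ₗ LinearMap.proj j

theorem aug_apply (v : Fin (r.betti 0) → MvPolynomial (Fin m) K) (j : Fin (r.betti 0)) :
    aug r v = aeval (fun _ : Fin m => (1 : K)) (v j) := by
  have : Subsingleton (Fin (r.betti 0)) := by rw [r.betti_zero]; infer_instance
  rw [aug, LinearMap.sum_apply, Fintype.sum_subsingleton _ j]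
  rfl

theorem aug_mulX (t : Fin m) (v : Fin (r.betti 0) → MvPolynomial (Fin m) K) :
    aug r (mulX K _ t v) = aug r v := by
  simp [aug, mulX_apply]

theorem aeval_X_pow_of_homogeneous {f : MvPolynomial (Fin m) K} {N : ℕ}
    (hf : ∀ s, coeff s f ≠ 0 → Finsupp.weight d s = N) :
    aeval (fun i => (Polynomial.X : Polynomial K) ^ d i) f =
      Polynomial.C (aeval (fun _ : Fin m => (1 : K)) f) * Polynomial.X ^ N := by
  rw [aeval_def, aeval_def, eval₂_eq, eval₂_eq, map_sum, sum_mul]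
  refine sum_congr rfl fun s hs => ?_
  rw [← hf s (mem_support_iff.1 hs), Finsupp.weight_apply, Finsupp.sum, ← prod_pow_eq_pow_sum]
  simp [← pow_mul, mul_comm]

theorem aug_eq_zero_iff {c : ℤ} {v : Fin (r.betti 0) → MvPolynomial (Fin m) K}
    (hv : v ∈ freeDeg K d (r.deg 0) c) : aug r v = 0 ↔ ∀ j, v j ∈ toricIdeal K d := by
  have key : ∀ j, v j ∈ toricIdeal K d ↔ aug r v = 0 := by
    intro j
    -- A homogeneous polynomial maps to its coefficient sum times `z ^ c`. For `c < 0` there are no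
    -- nonzero coefficients, so the truncation is harmless.
    rw [aug_apply r v j, toricIdeal, RingHom.mem_ker, aeval_X_pow_of_homogeneous (N := c.toNat)]
    · simp
    · intro s hs
      have := hv j s hs
      rw [r.deg_zero] at this
      omega
  simp only [key]
  exact ⟨fun h _ => h, fun h => h ⟨0, by rw [r.betti_zero]; exact one_pos⟩⟩

open Classical in
/-- The component of degree `c` of the semigroup ring, the basis element `z ^ c` being identified
with `1`. -/
noncomputable def ringDeg (K : Type*) [Field K] (d : Fin m → ℕ) (c : ℤ) : Submodule K K :=
  if c ∈ sgpInt d then ⊤ else ⊥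

theorem mem_sgpInt_iff {c : ℤ} :
    c ∈ sgpInt d ↔ ∃ s : Fin m →₀ ℕ, (Finsupp.weight d s : ℤ) = c := by
  have : ∀ a : ℕ, a ∈ sgp d ↔ ∃ s : Fin m →₀ ℕ, Finsupp.weight d s = a := by
    intro a
    rw [sgp, ← Submodule.span_nat_eq_addSubmonoidClosure, Submodule.mem_toAddSubmonoid,
      Finsupp.mem_span_range_iff_exists_finsupp]
    rfl
  constructor
  · rintro ⟨a, ha, rfl⟩
    obtain ⟨s, rfl⟩ := (this a).1 ha
    exact ⟨s, rfl⟩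
  · rintro ⟨s, rfl⟩
    exact ⟨_, (this _).2 ⟨s, rfl⟩, rfl⟩

theorem map_aug_freeDeg (c : ℤ) : (freeDeg K d (r.deg 0) c).map (aug r) = ringDeg K d c := by
  unfold ringDeg
  split_ifs with h
  · rw [eq_top_iff]
    rintro a -
    obtain ⟨s, rfl⟩ := mem_sgpInt_iff.1 h
    refine ⟨fun _ => monomial s a, ?_, ?_⟩
    · intro l t ht
      rw [coeff_monomial] at ht
      split_ifs at ht with hst
      · rw [hst, r.deg_zero]
        simp
      · exact absurd rfl ht
    · rw [aug_apply r _ ⟨0, by rw [r.betti_zero]; exact one_pos⟩]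
      simp [aeval_monomial]
  · rw [eq_bot_iff]
    rintro _ ⟨v, hv, rfl⟩
    have : v = 0 := by
      ext l s
      by_contra hne
      have := hv l s hne
      rw [r.deg_zero] at this
      exact h (mem_sgpInt_iff.2 ⟨s, by simpa using this⟩)
    simp [this]

theorem freeDeg_inf_ker_aug :
    (fun c => freeDeg K d (r.deg 0) c ⊓ LinearMap.ker (aug r)) =
      fun c => (freeDeg K d (r.deg 1) c).map (diffLin r 0) := by
  ext c v
  exact map_diffLin_freeDeg r 0 c (f := fun v => aug r v = 0)
    (fun v hv => (aug_eq_zero_iff r hv).trans (r.exact_zero v)) v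

theorem freeDeg_inf_ker_diffLin (i : ℕ) :
    (fun c => freeDeg K d (r.deg (i + 1)) c ⊓ LinearMap.ker (diffLin r i)) =
      fun c => (freeDeg K d (r.deg (i + 2)) c).map (diffLin r (i + 1)) := by
  ext c v
  exact map_diffLin_freeDeg r (i + 1) c (f := fun v => diffLin r i v = 0)
    (fun v hv => r.exact_succ i v) v

/-- Dimension shifting: each step lowers the homological degree `p` by one and moves to the next
syzygy module, until at `p = 0` the minimal generators are counted. -/
theorem hdim_syzygy [CharZero K] (hd : ∀ i, 0 < d i) (c : ℤ) (p q : ℕ) :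
    hdim d (mulX K (r.betti q)) (fun a => (freeDeg K d (r.deg (q + 1)) a).map (diffLin r q)) p c =
      #{l | (r.deg (q + p + 1) l : ℤ) = c} := by
  have hmin : ∀ q c, ∀ v ∈ freeDeg K d (r.deg (q + 1)) c, diffLin r q v = 0 →
      ∀ l, constantCoeff (v l) = 0 := by
    intro q c v hv h l
    obtain ⟨w, -, rfl⟩ : v ∈ (freeDeg K d (r.deg (q + 2)) c).map (diffLin r (q + 1)) := by
      rw [← congrFun (freeDeg_inf_ker_diffLin r q) c]
      exact ⟨hv, h⟩
    exact constantCoeff_diffLin r _ w l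
  induction p generalizing q with
  | zero => exact hdim_cover_zero hd (diffLin_mulX r q) (hmin q) c
  | succ p ih =>
    rw [hdim_cover_succ hd (diffLin_mulX r q) (hmin q) p c, freeDeg_inf_ker_diffLin, ih (q + 1),
      show q + 1 + p + 1 = q + (p + 1) + 1 by ring]

/-- The number of syzygies of degree `c` is the dimension of the Koszul homology of the semigroup
ring in degree `c`. -/
theorem card_deg_eq_hdim [CharZero K] (hd : ∀ i, 0 < d i) (i : ℕ) (c : ℤ) :
    #{l | (r.deg i l : ℤ) = c} = hdim d (fun _ => LinearMap.id) (ringDeg K d) i c := by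
  have hmin : ∀ c, ∀ v ∈ freeDeg K d (r.deg 0) c, aug r v = 0 →
      ∀ l, constantCoeff (v l) = 0 := by
    intro c v hv h l
    obtain ⟨w, -, rfl⟩ : v ∈ (freeDeg K d (r.deg 1) c).map (diffLin r 0) := by
      rw [← congrFun (freeDeg_inf_ker_aug r) c]
      exact ⟨hv, h⟩
    exact constantCoeff_diffLin r _ w l
  have e : ringDeg K d = fun c => (freeDeg K d (r.deg 0) c).map (aug r) :=
    funext fun c => (map_aug_freeDeg r c).symm
  rw [e]
  cases i with
  | zero => exact (hdim_cover_zero hd (aug_mulX r) hmin c).symm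
  | succ p =>
    rw [hdim_cover_succ hd (aug_mulX r) hmin p c, freeDeg_inf_ker_aug, hdim_syzygy r hd c p 0,
      zero_add]

end Betti

/-! ### The simplicial complexes attached to the semigroup; ranks and top homology. -/

section Simplicial

open Finset

variable {K : Type*} [Field K] {m : ℕ} {d : Fin m → ℕ}

/-- The functions vanishing outside `T`. -/
def suppOn (K : Type*) [Field K] {ι : Type*} (T : Finset ι) : Submodule K (ι → K) where
  carrier := {u | ∀ I, I ∉ T → u I = 0}
  add_mem' hu hv I h := by simp [hu I h, hv I h]
  zero_mem' _ _ := rfl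
  smul_mem' a u hu I h := by simp [hu I h]

theorem finrank_suppOn {ι : Type*} [DecidableEq ι] (T : Finset ι) :
    Module.finrank K (suppOn K T) = #T := by
  let e : suppOn K T ≃ₗ[K] (T → K) :=
    { toFun := fun u t => u.1 t.1
      map_add' := fun _ _ => rfl
      map_smul' := fun _ _ => rfl
      invFun := fun g => ⟨fun I => if h : I ∈ T then g ⟨I, h⟩ else 0, fun I h => dif_neg h⟩
      left_inv := fun u => by
        ext I
        by_cases h : I ∈ T
        · simp [h]
        · simp [h, u.2 I h]
      right_inv := fun g => by
        ext t
        simp }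
  rw [e.finrank_eq, Module.finrank_pi, Fintype.card_coe]

open Classical in
/-- The faces with `i` vertices of the simplicial complex of all `I` such that
`c - ∑_{j ∈ I} d_j ∈ S`. -/
noncomputable def faces (d : Fin m → ℕ) (i : ℕ) (c : ℤ) : Finset (Finset (Fin m)) :=
  {I | c - degSum d I ∈ sgpInt d ∧ #I = i}

theorem mem_faces {i : ℕ} {c : ℤ} {I : Finset (Fin m)} :
    I ∈ faces d i c ↔ c - degSum d I ∈ sgpInt d ∧ #I = i := by
  simp [faces]

theorem chains_ringDeg (i : ℕ) (c : ℤ) :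
    chains d (ringDeg K d) i c = suppOn K (faces d i c) := by
  ext u
  refine forall_congr' fun I => ?_
  rw [mem_faces, ringDeg]
  by_cases h1 : c - degSum d I ∈ sgpInt d <;> by_cases h2 : #I = i <;> simp [h1, h2]

/-- The differential of the chain complex of a simplicial complex. -/
abbrev sbdry (K : Type*) [Field K] (m : ℕ) :
    (Finset (Fin m) → K) →ₗ[K] (Finset (Fin m) → K) :=
  bdry fun _ : Fin m => LinearMap.id

theorem sgpInt_add {x y : ℤ} (hx : x ∈ sgpInt d) (hy : y ∈ sgpInt d) : x + y ∈ sgpInt d := by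
  obtain ⟨a, ha, rfl⟩ := hx
  obtain ⟨b, hb, rfl⟩ := hy
  exact ⟨a + b, add_mem ha hb, by push_cast; rfl⟩

theorem gen_mem_sgpInt (i : Fin m) : (d i : ℤ) ∈ sgpInt d :=
  ⟨d i, AddSubmonoid.subset_closure ⟨i, rfl⟩, rfl⟩

theorem zero_mem_sgpInt : (0 : ℤ) ∈ sgpInt d := ⟨0, zero_mem _, rfl⟩

theorem respectsDeg_ringDeg :
    RespectsDeg d (fun _ => LinearMap.id) (ringDeg K d) := by
  intro i a v hv
  unfold ringDeg at hv ⊢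
  split_ifs at hv with h
  · rw [if_pos (sgpInt_add h (gen_mem_sgpInt i))]
    trivial
  · rw [(Submodule.mem_bot K).1 hv, map_zero]
    exact zero_mem _

/-- The rank of the differential from `i + 1`-chains to `i`-chains. -/
noncomputable def bdim (K : Type*) [Field K] (d : Fin m → ℕ) (i : ℕ) (c : ℤ) : ℕ :=
  Module.finrank K (bds d (fun _ => LinearMap.id) (ringDeg K d) i c)

theorem bdim_add_finrank_cyc (i : ℕ) (c : ℤ) :
    bdim K d i c + Module.finrank K (cyc d (fun _ => LinearMap.id) (ringDeg K d) (i + 1) c) =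
      #(faces d (i + 1) c) := by
  rw [← finrank_suppOn (K := K), ← chains_ringDeg]
  have h := LinearMap.finrank_range_add_finrank_ker
    ((sbdry K m).domRestrict (chains d (ringDeg K d) (i + 1) c))
  rw [LinearMap.range_domRestrict] at h
  rw [← h, bdim, bds]
  congr 1
  have hle : cyc d (fun _ => LinearMap.id) (ringDeg K d) (i + 1) c ≤
      chains d (ringDeg K d) (i + 1) c := inf_le_left
  have he : (cyc d (fun _ => LinearMap.id) (ringDeg K d) (i + 1) c).submoduleOf
      (chains d (ringDeg K d) (i + 1) c) =
      LinearMap.ker ((sbdry K m).domRestrict (chains d (ringDeg K d) (i + 1) c)) := by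
    ext u
    exact ⟨fun hu => hu.2, fun hu => ⟨u.2, hu⟩⟩
  rw [← (Submodule.submoduleOfEquivOfLe hle).finrank_eq, he]

theorem hdim_add_bdim [CharZero K] (i : ℕ) (c : ℤ) :
    hdim d (fun _ => LinearMap.id) (ringDeg K d) i c + bdim K d i c =
      Module.finrank K (cyc d (fun _ => LinearMap.id) (ringDeg K d) i c) := by
  rw [hdim, ← Submodule.finrank_quotient_add_finrank ((bds d (fun _ => LinearMap.id)
    (ringDeg K d) i c).submoduleOf (cyc d (fun _ => LinearMap.id) (ringDeg K d) i c))]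
  congr 1
  refine (Submodule.submoduleOfEquivOfLe ?_).symm.finrank_eq
  rintro _ ⟨u, hu, rfl⟩
  exact ⟨bdry_mem_chains respectsDeg_ringDeg hu,
    LinearMap.mem_ker.2 (bdry_bdry (fun _ _ _ => rfl) u)⟩

theorem hdim_zero_add_bdim [CharZero K] (c : ℤ) :
    hdim d (fun _ => LinearMap.id) (ringDeg K d) 0 c + bdim K d 0 c = #(faces d 0 c) := by
  rw [hdim_add_bdim, ← finrank_suppOn (K := K), ← chains_ringDeg, cyc, inf_eq_left.2]
  exact fun u hu => LinearMap.mem_ker.2 (bdry_eq_zero_of_mem_chains_zero _ hu)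

theorem hdim_succ_add_bdim [CharZero K] (i : ℕ) (c : ℤ) :
    hdim d (fun _ => LinearMap.id) (ringDeg K d) (i + 1) c + bdim K d (i + 1) c + bdim K d i c =
      #(faces d (i + 1) c) := by
  rw [hdim_add_bdim, add_comm, bdim_add_finrank_cyc]

theorem sbdry_apply_erase {u : Finset (Fin m) → K} {t : Fin m} {J : Finset (Fin m)} (ht : t ∈ J)
    (hu : ∀ I, t ∉ I → u I = 0) : sbdry K m u (J.erase t) = sgn K t (J.erase t) * u J := by
  rw [bdry_apply, sum_eq_single t]
  · simp [insert_erase ht]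
  · intro i _ hi
    split_ifs with h
    · rfl
    · rw [hu _ (by simp [Ne.symm hi])]
      simp
  · simp

/-- The differential is injective on chains supported on faces through `t`: its coefficient at
`J.erase t` is `± u J`, as every other contribution comes from a set without `t`. -/
theorem card_le_bdim (t : Fin m) (i : ℕ) (c : ℤ) :
    #{J ∈ faces d (i + 1) c | t ∈ J} ≤ bdim K d i c := by
  rw [← finrank_suppOn (K := K), bdim, bds, chains_ringDeg]
  have hinj : Function.Injective
      ((sbdry K m).domRestrict (suppOn K {J ∈ faces d (i + 1) c | t ∈ J})) := by
    rw [← LinearMap.ker_eq_bot, LinearMap.ker_eq_bot']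
    rintro ⟨u, hu⟩ h
    have hu' : ∀ I, t ∉ I → u I = 0 := fun I hI => hu I (by simp [hI])
    ext J
    by_cases hJ : t ∈ J
    · have h1 := sbdry_apply_erase hJ hu'
      have h2 : sbdry K m u (J.erase t) = 0 := congrFun h _
      rw [h2] at h1
      exact (mul_eq_zero.1 h1.symm).resolve_left (sgn_ne_zero _ _)
    · exact hu' J hJ
  rw [← LinearMap.finrank_range_of_inj hinj, LinearMap.range_domRestrict]
  refine Submodule.finrank_mono (Submodule.map_mono ?_)
  exact fun u hu I hI => hu I fun h => hI (mem_filter.1 h).1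

theorem mem_pseudoFrob_iff (hd : ∀ i, 0 < d i) {f : ℤ} :
    f ∈ pseudoFrob d ↔ f ∉ sgpInt d ∧ ∀ i, f + d i ∈ sgpInt d := by
  refine and_congr_right fun _ => ⟨fun h i => h _ (gen_mem_sgpInt i) ?_, fun h s hs hs0 => ?_⟩
  · have := hd i
    omega
  · obtain ⟨t, rfl⟩ := mem_sgpInt_iff.1 hs
    have ht : t ≠ 0 := by
      rintro rfl
      simp at hs0
    obtain ⟨i, hi⟩ := Finsupp.ne_iff.1 ht
    have h2 : t = (t - Finsupp.single i 1) + Finsupp.single i 1 := by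
      rw [tsub_add_cancel_of_le]
      simpa [Nat.one_le_iff_ne_zero] using hi
    have h3 := sgpInt_add (h i) (mem_sgpInt_iff.2 ⟨t - Finsupp.single i 1, rfl⟩)
    rw [h2, map_add, Finsupp.weight_single]
    push_cast
    simp only [smul_eq_mul, one_mul]
    convert h3 using 1
    ring

theorem degSum_univ : degSum d univ = sumGen d := rfl

theorem degSum_univ_erase (i : Fin m) : degSum d (univ.erase i) = sumGen d - d i := by
  have := degSum_insert d (notMem_erase i univ)
  rw [insert_erase (mem_univ i), degSum_univ] at this
  linarith

theorem bdim_pred_card {p : ℕ} (hp : p + 1 = m) (c : ℤ) :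
    bdim K d p c = #(faces d (p + 1) c) := by
  let t : Fin m := ⟨0, by omega⟩
  have h3 := card_le_bdim (K := K) (d := d) t p c
  have h4 : {J ∈ faces d (p + 1) c | t ∈ J} = faces d (p + 1) c := by
    refine filter_true_of_mem fun J hJ => ?_
    have : J = univ := by
      rw [← card_eq_iff_eq_univ, Fintype.card_fin, (mem_faces.1 hJ).2, hp]
    rw [this]
    exact mem_univ t
  have h5 := bdim_add_finrank_cyc (K := K) (d := d) p c
  rw [h4] at h3
  omega

open Classical in
-- Every cycle of this size is a multiple of the boundary `w` of the full simplex. A nonzero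
-- multiple is a chain iff all facets are faces, that is `c - Σ_m + d_i ∈ S` for all `i`, and it
-- bounds iff the full simplex is a face, that is `c - Σ_m ∈ S`.
theorem hdim_pred_card [CharZero K] (hd : ∀ i, 0 < d i) {p : ℕ} (hp : p + 1 = m) (c : ℤ) :
    hdim d (fun _ => LinearMap.id) (ringDeg K d) p c =
      if c - sumGen d ∈ pseudoFrob d then 1 else 0 := by
  have h1 := hdim_add_bdim (K := K) (d := d) p c
  let t : Fin m := ⟨0, by omega⟩
  have hface : ∀ i, univ.erase i ∈ faces d p c ↔ c - sumGen d + d i ∈ sgpInt d := by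
    intro i
    rw [mem_faces, degSum_univ_erase, card_erase_of_mem (mem_univ i), card_univ, Fintype.card_fin,
      and_iff_left (by omega)]
    ring_nf
  have hb : bdim K d p c = if c - sumGen d ∈ sgpInt d then 1 else 0 := by
    rw [bdim_pred_card hp]
    have : ∀ I : Finset (Fin m), #I = p + 1 ↔ I = univ := by
      intro I
      rw [← card_eq_iff_eq_univ, Fintype.card_fin, hp]
    split_ifs with h
    · rw [card_eq_one]
      refine ⟨univ, ?_⟩
      ext I
      rw [mem_faces, this, mem_singleton, and_iff_right_iff_imp]
      rintro rfl
      rwa [degSum_univ]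
    · rw [card_eq_zero, eq_empty_iff_forall_notMem]
      intro I
      rw [mem_faces, this]
      rintro ⟨h', rfl⟩
      exact h h'
  set w : Finset (Fin m) → K := sbdry K m (Pi.single univ 1) with hw
  have hwi : ∀ i, w (univ.erase i) ≠ 0 := by
    intro i
    rw [hw, sbdry_apply_erase (mem_univ i)]
    · simp [sgn_ne_zero]
    · intro I hI
      rw [Pi.single_eq_of_ne]
      rintro rfl
      exact hI (mem_univ i)
  have hspan : ∀ u ∈ cyc d (fun _ => LinearMap.id) (ringDeg K d) p c, ∃ a : K, a • w = u := by
    rintro u ⟨hu, hker⟩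
    rw [SetLike.mem_coe, LinearMap.mem_ker] at hker
    -- The full simplex is a cone with apex `t`, so the cycle `u` bounds `e_t ∧ u`, which lives on
    -- `univ` alone.
    have h2 : sbdry K m (wedge K K t u) = u := by
      have e : wedge K K t (sbdry K m u) = 0 := by
        rw [hker, map_zero]
      rw [bdry_eq, map_sum] at e
      rw [bdry_eq, ← add_zero (∑ i, _), ← e, ← sum_add_distrib, sum_eq_single t]
      · exact contr_wedge_self t u
      · intro i _ hi
        exact contr_wedge_of_ne hi u
      · simp
    refine ⟨wedge K K t u univ, ?_⟩
    rw [hw, ← map_smul]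
    refine Eq.trans (congrArg _ ?_) h2
    ext I
    by_cases hI : I = univ
    · simp [hI]
    · rw [Pi.smul_apply, Pi.single_eq_of_ne hI, smul_zero, wedge_apply]
      split_ifs with ht
      · rw [(hu _).2, smul_zero]
        intro h3
        apply hI
        rw [← card_eq_iff_eq_univ, Fintype.card_fin, ← card_erase_add_one ht, h3, hp]
      · rfl
  have hc : Module.finrank K (cyc d (fun _ => LinearMap.id) (ringDeg K d) p c) =
      if ∀ i, c - sumGen d + d i ∈ sgpInt d then 1 else 0 := by
    split_ifs with h
    · have : cyc d (fun _ => LinearMap.id) (ringDeg K d) p c = Submodule.span K {w} := by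
        apply le_antisymm
        · intro u hu
          exact Submodule.mem_span_singleton.2 (hspan u hu)
        · rw [Submodule.span_singleton_le_iff_mem]
          refine ⟨?_, LinearMap.mem_ker.2 (bdry_bdry (fun _ _ _ => rfl) _)⟩
          rw [chains_ringDeg]
          intro I hI
          rw [hw, bdry_apply]
          refine sum_eq_zero fun i _ => ?_
          split_ifs with hi
          · rfl
          · rw [Pi.single_eq_of_ne, map_zero, smul_zero]
            intro h'
            apply hI
            rw [← erase_insert hi, h']
            exact (hface i).2 (h i)
      rw [this]
      refine finrank_span_singleton fun h0 => hwi t ?_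
      rw [h0]
      rfl
    · rw [Submodule.finrank_eq_zero, Submodule.eq_bot_iff]
      intro u hu
      obtain ⟨a, rfl⟩ := hspan u hu
      push Not at h
      obtain ⟨i, hi⟩ := h
      have h2 := hu.1
      rw [chains_ringDeg] at h2
      have h3 := h2 (univ.erase i) fun h' => hi ((hface i).1 h')
      rw [(mul_eq_zero.1 h3).resolve_right (hwi i), zero_smul]
  rw [hb, hc] at h1
  rw [mem_pseudoFrob_iff hd]
  by_cases hS : c - sumGen d ∈ sgpInt d
  · have : ∀ i, c - sumGen d + d i ∈ sgpInt d := fun i => sgpInt_add hS (gen_mem_sgpInt i)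
    rw [if_pos hS, if_pos this] at h1
    rw [if_neg (by tauto)]
    omega
  · rw [if_neg hS] at h1
    simpa [hS] using h1

end Simplicial

/-! ### Graded Euler characteristic and the bound for the total Betti number. -/

section Counting

open Finset

variable {K : Type*} [Field K] {m : ℕ} {d : Fin m → ℕ}

theorem alternating_sum_of_ranks {h ρ n : ℕ → ℕ} (h0 : h 0 + ρ 0 = n 0)
    (hs : ∀ i, h (i + 1) + ρ (i + 1) + ρ i = n (i + 1)) (p : ℕ) :
    ∑ i ∈ range (p + 1), (-1 : ℤ) ^ i * h i =
      ∑ i ∈ range (p + 1), (-1 : ℤ) ^ i * n i - (-1) ^ p * ρ p := by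
  induction p with
  | zero => simp [← h0]
  | succ p ih =>
    rw [sum_range_succ, ih, sum_range_succ _ (p + 1), ← hs p]
    push_cast
    ring

/-- Here `h`, `ρ`, `n` stand for dimensions of homology, ranks of the differentials into `i`-chains,
and numbers of faces. Every rank enters two relations except the last, which enters one. -/
theorem sum_of_ranks {h ρ n : ℕ → ℕ} (h0 : h 0 + ρ 0 = n 0)
    (hs : ∀ i, h (i + 1) + ρ (i + 1) + ρ i = n (i + 1)) (p : ℕ) :
    ∑ i ∈ range (p + 1), h i + 2 * ∑ i ∈ range (p + 1), ρ i =
      ∑ i ∈ range (p + 1), n i + ρ p := by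
  induction p with
  | zero => simp; omega
  | succ p ih =>
    rw [sum_range_succ, sum_range_succ _ (p + 1), sum_range_succ _ (p + 1)]
    have := hs p
    omega

/-- The number of syzygies of homological degree `i` and degree `c`. -/
def syzCount (r : MinimalResolution K d) (i : ℕ) (c : ℤ) : ℕ := #{l | (r.deg i l : ℤ) = c}

open Classical in
theorem sum_faces_range {M : Type*} [AddCommMonoid M] (g : ℕ → M) (c : ℤ) :
    ∑ i ∈ range (m + 1), #(faces d i c) • g i =
      ∑ I, if c - degSum d I ∈ sgpInt d then g #I else 0 := by
  rw [← sum_filter, ← sum_fiberwise_of_maps_to (t := range (m + 1)) (g := fun I => #I)]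
  · refine sum_congr rfl fun i _ => ?_
    rw [sum_congr rfl (g := fun _ => g i), sum_const]
    · congr 1
      rw [faces, filter_filter]
    · intro I hI
      rw [(mem_filter.1 hI).2]
  · intro I _
    have := card_le_univ I
    rw [Fintype.card_fin] at this
    rw [mem_range]
    omega

open Classical in
/-- The graded Euler characteristic of the resolution. -/
theorem alternating_sum_syzCount [CharZero K] (hd : ∀ i, 0 < d i) (r : MinimalResolution K d)
    (hm : 0 < m) (c : ℤ) :
    ∑ i ∈ range m, (-1 : ℤ) ^ i * syzCount r i c =
      ∑ I : Finset (Fin m), if c - degSum d I ∈ sgpInt d then (-1) ^ #I else 0 := by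
  obtain ⟨p, rfl⟩ : ∃ p, m = p + 1 := ⟨m - 1, by omega⟩
  have h := alternating_sum_of_ranks
    (h := fun i => hdim d (fun _ => LinearMap.id) (ringDeg K d) i c)
    (ρ := fun i => bdim K d i c) (n := fun i => #(faces d i c)) (hdim_zero_add_bdim (K := K) (d := d) c)
    (fun i => hdim_succ_add_bdim i c) p
  rw [bdim_pred_card rfl] at h
  rw [← sum_faces_range (fun i => (-1 : ℤ) ^ i), sum_range_succ _ (p + 1)]
  simp only [syzCount, card_deg_eq_hdim r hd]
  rw [h]
  simp only [nsmul_eq_mul, mul_comm]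
  ring

theorem gen_sub_gen_notMem (hd : IsMinimalGenerating d) {i j : Fin m} (hij : i ≠ j) :
    (d j : ℤ) - d i ∉ sgpInt d := by
  intro h
  obtain ⟨s, hs⟩ := mem_sgpInt_iff.1 h
  have hi := hd.pos i
  have hsj : s j = 0 := by
    by_contra hne
    have h2 : s j * d j ≤ Finsupp.weight d s := by
      rw [Finsupp.weight_eq_sum]
      exact single_le_sum (f := fun i => s i • d i) (fun _ _ => Nat.zero_le _) (mem_univ j)
    have h3 : 1 * d j ≤ s j * d j := Nat.mul_le_mul_right _ (Nat.one_le_iff_ne_zero.2 hne)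
    omega
  apply hd.minimal j
  have e : d j = d i + ∑ l, s l • d l := by
    rw [← Finsupp.weight_eq_sum]
    omega
  rw [e]
  refine add_mem (AddSubmonoid.subset_closure (Set.mem_image_of_mem d hij)) (sum_mem fun l _ => ?_)
  by_cases hl : l = j
  · rw [hl, hsj, zero_smul]
    exact zero_mem _
  · exact nsmul_mem (AddSubmonoid.subset_closure (Set.mem_image_of_mem d hl)) _

open Classical in
-- The ranks add up to at least the number of faces through `t`. Deleting `t` pairs these with the
-- `I ∌ t` for which `insert t I` is a face; such `I` are faces too. Taking away both members of
-- each pair leaves the faces counted on the right.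
theorem sum_syzCount_le [CharZero K] (hd : IsMinimalGenerating d) (r : MinimalResolution K d)
    (t : Fin m) (c : ℤ) :
    ∑ i ∈ range m, syzCount r i c + 2 * (if ∃ j, j ≠ t ∧ (d j : ℤ) = c then 1 else 0) ≤
      #{I : Finset (Fin m) | t ∉ I ∧ c - degSum d I ∈ sgpInt d ∧
        c - degSum d I - d t ∉ sgpInt d} := by
  obtain ⟨p, rfl⟩ : ∃ p, m = p + 1 := ⟨m - 1, by have := t.2; omega⟩
  have h := sum_of_ranks
    (h := fun i => hdim d (fun _ => LinearMap.id) (ringDeg K d) i c)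
    (ρ := fun i => bdim K d i c) (n := fun i => #(faces d i c)) (hdim_zero_add_bdim (K := K) (d := d) c)
    (fun i => hdim_succ_add_bdim i c) p
  rw [bdim_pred_card rfl, ← sum_range_succ (fun i => #(faces d i c))] at h
  simp only [← card_deg_eq_hdim r hd.pos] at h
  change ∑ i ∈ range (p + 1), syzCount r i c + _ = _ at h
  have h1 := sum_faces_range (d := d) (fun _ => 1) c
  simp only [smul_eq_mul, mul_one] at h1
  rw [h1, sum_boole, Nat.cast_id] at h
  have h2 : ∑ i ∈ range (p + 1), #{J ∈ faces d (i + 1) c | t ∈ J} =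
      #{J : Finset (Fin (p + 1)) | c - degSum d J ∈ sgpInt d ∧ t ∈ J} := by
    rw [card_eq_sum_card_fiberwise (f := fun J => #J - 1) (t := range (p + 1))]
    · refine sum_congr rfl fun i _ => ?_
      congr 1
      ext J
      simp only [mem_filter, mem_faces, mem_univ, true_and]
      constructor
      · rintro ⟨⟨h, h'⟩, h''⟩
        exact ⟨⟨h, h''⟩, by omega⟩
      · rintro ⟨⟨h, h'⟩, h''⟩
        have := card_pos.2 ⟨t, h'⟩
        exact ⟨⟨h, by omega⟩, h'⟩
    · intro J _
      have := card_le_univ J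
      rw [Fintype.card_fin] at this
      rw [mem_coe, mem_range]
      change #J - 1 < p + 1
      omega
  -- In degree `d j` with `j ≠ t`, minimality of the generators shows that `{t}` is not a face,
  -- while `{j}` is one. So the lowest rank is at least one, although no one-vertex face contains
  -- `t`.
  have h3 : (∑ i ∈ range (p + 1), #{J ∈ faces d (i + 1) c | t ∈ J}) +
      (if ∃ j, j ≠ t ∧ (d j : ℤ) = c then 1 else 0) ≤ ∑ i ∈ range (p + 1), bdim K d i c := by
    rw [sum_range_succ', sum_range_succ', add_assoc]
    refine add_le_add (sum_le_sum fun i _ => card_le_bdim t _ _) ?_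
    split_ifs with hj
    · obtain ⟨j, hjt, rfl⟩ := hj
      have e1 : #{J ∈ faces d (0 + 1) (d j : ℤ) | t ∈ J} = 0 := by
        rw [card_eq_zero, filter_eq_empty_iff]
        intro J hJ htJ
        rw [mem_faces, zero_add, card_eq_one] at hJ
        obtain ⟨hJ, a, rfl⟩ := hJ
        obtain rfl := mem_singleton.1 htJ
        rw [degSum, sum_singleton] at hJ
        exact gen_sub_gen_notMem hd hjt.symm hJ
      have e2 : 1 ≤ #{J ∈ faces d (0 + 1) (d j : ℤ) | j ∈ J} := by
        rw [Nat.one_le_iff_ne_zero, ← Nat.pos_iff_ne_zero, card_pos]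
        refine ⟨{j}, mem_filter.2 ⟨mem_faces.2 ⟨?_, by simp⟩, by simp⟩⟩
        rw [degSum, sum_singleton, sub_self]
        exact zero_mem_sgpInt
      have e3 := card_le_bdim (K := K) (d := d) j 0 (d j : ℤ)
      omega
    · exact card_le_bdim t _ _
  have h4 : #{J : Finset (Fin (p + 1)) | c - degSum d J ∈ sgpInt d ∧ t ∈ J} =
      #{I : Finset (Fin (p + 1)) | t ∉ I ∧ c - degSum d I - d t ∈ sgpInt d} := by
    refine card_bij' (fun J _ => J.erase t) (fun I _ => insert t I) ?_ ?_ ?_ ?_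
    · intro J hJ
      simp only [mem_filter, mem_univ, true_and] at hJ ⊢
      refine ⟨notMem_erase t J, ?_⟩
      have := degSum_insert d (notMem_erase t J)
      rw [insert_erase hJ.2] at this
      have e : c - degSum d (J.erase t) - d t = c - degSum d J := by
        rw [this]
        ring
      rw [e]
      exact hJ.1
    · intro I hI
      simp only [mem_filter, mem_univ, true_and] at hI ⊢
      refine ⟨?_, mem_insert_self t I⟩
      have e : c - (d t + degSum d I) = c - degSum d I - d t := by ring
      rw [degSum_insert d hI.1, e]
      exact hI.2
    · intro J hJ
      exact insert_erase (mem_filter.1 hJ).2.2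
    · intro I hI
      exact erase_insert (mem_filter.1 hI).2.1
  have h5 : #{I : Finset (Fin (p + 1)) | c - degSum d I ∈ sgpInt d} =
      #{J : Finset (Fin (p + 1)) | c - degSum d J ∈ sgpInt d ∧ t ∈ J} +
      (#{I : Finset (Fin (p + 1)) | t ∉ I ∧ c - degSum d I - d t ∈ sgpInt d} +
      #{I : Finset (Fin (p + 1)) | t ∉ I ∧ c - degSum d I ∈ sgpInt d ∧
        c - degSum d I - d t ∉ sgpInt d}) := by
    rw [← card_union_of_disjoint, ← card_union_of_disjoint]
    · congr 1
      ext I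
      simp only [mem_filter, mem_union, mem_univ, true_and]
      constructor
      · intro h
        tauto
      · rintro (h | h | h)
        · exact h.1
        · have := sgpInt_add h.2 (gen_mem_sgpInt t)
          rwa [sub_add_cancel] at this
        · exact h.2.1
    · rw [disjoint_left]
      intro I hI hI'
      simp only [mem_filter, mem_union, mem_univ, true_and] at hI hI'
      tauto
    · rw [disjoint_left]
      intro I hI hI'
      simp only [mem_filter, mem_univ, true_and] at hI hI'
      tauto
  omega

theorem sub_mul_mem_sgpInt {x : ℤ} (hx : x ∈ sgpInt d) (t : Fin m) (n : ℕ) :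
    x + n * d t ∈ sgpInt d := by
  induction n with
  | zero => simpa using hx
  | succ n ih =>
    have := sgpInt_add ih (gen_mem_sgpInt t)
    convert this using 1
    push_cast
    ring

open Classical in
-- Apéry elements are distinct modulo `d t`: otherwise adding multiples of `d t` to the smaller one
-- would reach the larger one minus `d t` inside `S`.
theorem card_apery_le (hd : ∀ i, 0 < d i) (t : Fin m) (T : Finset ℤ) (a : ℤ) :
    #{c ∈ T | c - a ∈ sgpInt d ∧ c - a - d t ∉ sgpInt d} ≤ d t := by
  have ht := hd t
  refine (card_le_card_of_injOn (t := range (d t)) (fun c => ((c - a) % d t).toNat)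
    ?_ ?_).trans (card_range _).le
  · intro c _
    have h1 := Int.emod_nonneg (c - a) (b := d t) (by omega)
    have h2 := Int.emod_lt_of_pos (c - a) (b := d t) (by omega)
    simp only [coe_range, Set.mem_Iio]
    omega
  · have key : ∀ c c' : ℤ, c - a ∈ sgpInt d → c' - a - d t ∉ sgpInt d →
        (c - a) % d t = (c' - a) % d t → c' ≤ c := by
      intro c c' h1 h2 h3
      by_contra hlt
      obtain ⟨q, hq⟩ := Int.ModEq.dvd h3
      have hq0 : 0 < q := by
        by_contra hq0
        have : (d t : ℤ) * q ≤ 0 := mul_nonpos_of_nonneg_of_nonpos (by omega) (by omega)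
        omega
      apply h2
      have := sub_mul_mem_sgpInt h1 t (q - 1).toNat
      convert this using 1
      rw [Int.toNat_of_nonneg (by omega)]
      linarith
    intro c hc c' hc' h
    simp only [coe_filter, Set.mem_ofPred_eq] at hc hc'
    have h1 := Int.emod_nonneg (c - a) (b := d t) (by omega)
    have h2 := Int.emod_nonneg (c' - a) (b := d t) (by omega)
    have h3 : (c - a) % d t = (c' - a) % d t := by
      dsimp only at h
      omega
    exact le_antisymm (key _ _ hc'.2.1 hc.2.2 h3.symm) (key _ _ hc.2.1 hc'.2.2 h3)

/-- A bound for the sum of the Betti numbers in terms of the embedding dimension and any of the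
generators. -/
theorem sum_betti_add_le [CharZero K] (hd : IsMinimalGenerating d) (r : MinimalResolution K d)
    (t : Fin m) :
    ∑ i ∈ range m, r.betti i + 2 * (m - 1) ≤ d t * 2 ^ (m - 1) := by
  classical
  -- Large enough to see every syzygy and all `m - 1` degrees in which the rank bound improves.
  let T : Finset ℤ := ((range m).biUnion fun i => univ.image fun l => (r.deg i l : ℤ)) ∪
    univ.image fun j => (d j : ℤ)
  have h1 : ∀ i ∈ range m, r.betti i = ∑ c ∈ T, syzCount r i c := by
    intro i hi
    rw [← Fintype.card_fin (r.betti i), ← card_univ]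
    refine card_eq_sum_card_fiberwise fun l _ => ?_
    exact mem_coe.2 (mem_union_left _ (mem_biUnion.2 ⟨i, hi, mem_image_of_mem _ (mem_univ l)⟩))
  have h2 : m - 1 ≤ ∑ c ∈ T, if ∃ j, j ≠ t ∧ (d j : ℤ) = c then 1 else 0 := by
    rw [sum_boole, Nat.cast_id]
    have : #(univ.erase t) = m - 1 := by
      rw [card_erase_of_mem (mem_univ t), card_univ, Fintype.card_fin]
    rw [← this]
    refine card_le_card_of_injOn (fun j => (d j : ℤ)) ?_ ?_
    · intro j hj
      exact mem_coe.2 (mem_filter.2 ⟨mem_union_right _ (mem_image_of_mem _ (mem_univ j)), j,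
        (mem_erase.1 hj).1, rfl⟩)
    · intro j _ j' _ h
      exact hd.strictMono.injective (Nat.cast_injective (R := ℤ) h)
  have h3 := sum_le_sum fun c (_ : c ∈ T) => sum_syzCount_le hd r t c
  have h5 : ∑ i ∈ range m, r.betti i = _ := sum_congr rfl h1
  rw [sum_add_distrib, ← mul_sum, sum_comm, ← h5] at h3
  have h4 : ∑ c ∈ T, #{I : Finset (Fin m) | t ∉ I ∧ c - degSum d I ∈ sgpInt d ∧
      c - degSum d I - d t ∉ sgpInt d} ≤ d t * 2 ^ (m - 1) := by
    simp only [card_filter, ite_and]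
    rw [sum_comm]
    have : ∀ I : Finset (Fin m), (∑ c ∈ T, if t ∉ I then if c - degSum d I ∈ sgpInt d then
        if c - degSum d I - d t ∉ sgpInt d then 1 else 0 else 0 else 0) ≤
        if t ∉ I then d t else 0 := by
      intro I
      split_ifs with h
      · simp
      · simpa only [card_filter, ite_and] using card_apery_le hd.pos t T (degSum d I)
    refine (sum_le_sum fun I _ => this I).trans ?_
    rw [← sum_filter, sum_const, smul_eq_mul, mul_comm]
    have e : ({I | t ∉ I} : Finset (Finset (Fin m))) = (univ.erase t).powerset := by
      ext I
      simp [subset_erase]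
    rw [e, card_powerset, card_erase_of_mem (mem_univ t), card_univ, Fintype.card_fin]
  omega

end Counting

/-! ### Almost symmetry, the functional equation and the formula for `δ`. -/

section AlmostSymmetric

open Finset

variable {K : Type*} [Field K] {m : ℕ} {d : Fin m → ℕ}

theorem mem_sgpInt_of_frob_lt (hd : IsMinimalGenerating d) {x : ℤ} (hx : frob d < x) :
    x ∈ sgpInt d := by
  unfold frob at hx
  refine ⟨conductor d + (x - conductor d).toNat, (conductor_spec hd).2 _, ?_⟩
  push_cast
  omega

theorem frob_notMem_sgpInt (hd : IsMinimalGenerating d) : frob d ∉ sgpInt d := by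
  rintro ⟨a, ha, h⟩
  have hc : conductor d = a + 1 := by
    unfold frob at h
    dsimp only at h
    omega
  have : conductor d ≤ a := by
    refine Nat.sInf_le ⟨ha, fun n => ?_⟩
    cases n with
    | zero => exact ha
    | succ n =>
      have := (conductor_spec hd).2 n
      rwa [hc, add_assoc, add_comm 1 n] at this
  omega

theorem frob_mem_pseudoFrob (hd : IsMinimalGenerating d) : frob d ∈ pseudoFrob d := by
  rw [mem_pseudoFrob_iff hd.pos]
  refine ⟨frob_notMem_sgpInt hd, fun i => mem_sgpInt_of_frob_lt hd ?_⟩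
  have := hd.pos i
  omega

theorem frob_notMem_deltaH (hd : IsMinimalGenerating d) : frob d ∉ deltaH d := by
  rw [mem_deltaH hd, sub_self]
  exact fun h => h.2 zero_mem_sgpInt

theorem frob_sub_mem_deltaH (hd : IsMinimalGenerating d) {x : ℤ} :
    frob d - x ∈ deltaH d ↔ x ∈ deltaH d := by
  rw [mem_deltaH hd, mem_deltaH hd, sub_sub_cancel, and_comm]

theorem mem_pseudoFrob_iff_of_isAlmostSymmetric (hd : IsMinimalGenerating d)
    (has : IsAlmostSymmetric d) (x : ℤ) : x ∈ pseudoFrob d ↔ x = frob d ∨ x ∈ deltaH d := by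
  have h : x ∈ pseudoFrob d \ {frob d} ↔ x ∈ (deltaH d : Set ℤ) := by
    rw [IsAlmostSymmetric] at has
    rw [has]
  rw [Set.mem_sdiff, Set.mem_singleton_iff, mem_coe] at h
  by_cases hx : x = frob d
  · simp [hx, frob_mem_pseudoFrob hd]
  · simpa [hx] using h

open Classical in
theorem indicator_sgpInt_add (hd : IsMinimalGenerating d) (x : ℤ) :
    (if x ∈ sgpInt d then 1 else 0 : ℤ) + (if frob d - x ∈ sgpInt d then 1 else 0) +
      (if x ∈ deltaH d then 1 else 0) = 1 := by
  have h0 : ¬ (x ∈ sgpInt d ∧ frob d - x ∈ sgpInt d) := by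
    rintro ⟨h1, h2⟩
    apply frob_notMem_sgpInt hd
    have := sgpInt_add h1 h2
    rwa [add_sub_cancel] at this
  simp only [mem_deltaH hd]
  by_cases h1 : x ∈ sgpInt d <;> by_cases h2 : frob d - x ∈ sgpInt d <;> simp_all

/-- The number of representations of `c` as a sum of `q` generators with distinct indices and an
element of `Δ_H`. -/
theorem count_genGapSums (q : ℕ) (c : ℤ) :
    (genGapSums d q).count c =
      ∑ I ∈ powersetCard q univ, if c - degSum d I ∈ deltaH d then 1 else 0 := by
  have h : genGapSums d q = (powersetCard q (univ : Finset (Fin m))).val.bind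
      fun I => (deltaH d).val.map fun h => degSum d I + h := by
    rw [genGapSums, genSums]
    induction (powersetCard q (univ : Finset (Fin m))).val using Multiset.induction_on with
    | empty => simp
    | cons I s ih =>
      rw [Multiset.map_cons, Multiset.cons_product, Multiset.map_add, ih, Multiset.cons_bind,
        Multiset.map_map]
      rfl
  rw [h, Multiset.count_bind]
  change (Multiset.map _ _).sum = (Multiset.map _ _).sum
  congr 2
  funext I
  have e : c = degSum d I + (c - degSum d I) := by ring
  conv_lhs => rw [e]
  rw [Multiset.count_map_eq_count' _ _ (add_right_injective _)]
  exact Multiset.count_eq_of_nodup (deltaH d).nodup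

theorem card_genGapSums (q : ℕ) : Multiset.card (genGapSums d q) = m.choose q * gam d := by
  rw [genGapSums, Multiset.card_map, Multiset.card_product, genSums, Multiset.card_map, gam]
  simp

theorem count_syz (r : MinimalResolution K d) (i : ℕ) (c : ℤ) :
    (syz r i).count c = syzCount r i c := by
  rw [syz, Multiset.count_map, syzCount]
  simp only [eq_comm]
  rfl

theorem count_syzBar (r : MinimalResolution K d) (i : ℕ) (c : ℤ) :
    (syzBar r i).count c = syzCount r i (frob d + sumGen d - c) := by
  rw [syzBar, Multiset.count_map, syzCount]
  have : ∀ l, c = -(r.deg i l : ℤ) + frob d + sumGen d ↔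
      (r.deg i l : ℤ) = frob d + sumGen d - c := by
    intro l
    constructor <;> intro h <;> linarith
  simp only [this]
  rfl

theorem card_syz (r : MinimalResolution K d) (i : ℕ) : Multiset.card (syz r i) = r.betti i := by
  simp [syz]

theorem card_syzBar (r : MinimalResolution K d) (i : ℕ) :
    Multiset.card (syzBar r i) = r.betti i := by
  simp [syzBar]

theorem sum_even_sub_sum_odd (s : Finset ℕ) (g : ℕ → ℤ) :
    ∑ i ∈ s with Even i, g i - ∑ i ∈ s with Odd i, g i = ∑ i ∈ s, (-1) ^ i * g i := by
  rw [sum_filter, sum_filter, ← sum_sub_distrib]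
  refine sum_congr rfl fun i _ => ?_
  rcases Nat.even_or_odd i with h | h
  · simp [h, Nat.not_odd_iff_even.2 h, h.neg_one_pow]
  · simp [h, Nat.not_even_iff_odd.2 h, h.neg_one_pow]

theorem sum_even_add_sum_odd {M : Type*} [AddCommMonoid M] (s : Finset ℕ) (g : ℕ → M) :
    ∑ i ∈ s with Even i, g i + ∑ i ∈ s with Odd i, g i = ∑ i ∈ s, g i := by
  simp only [← Nat.not_even_iff_odd]
  exact sum_filter_add_sum_filter_not s _ g

theorem sum_range_eq_add_sum_Icc_add {M : Type*} [AddCommMonoid M] (f : ℕ → M) (p : ℕ) :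
    ∑ i ∈ range (p + 2), f i = f 0 + ∑ i ∈ Icc 1 p, f i + f (p + 1) := by
  rw [sum_range_succ, sum_range_succ', add_comm _ (f 0)]
  congr 2
  rw [← Ico_add_one_right_eq_Icc, sum_Ico_eq_sum_range]
  simp [add_comm]

theorem sum_alternating_powersetCard (c : ℤ) :
    ∑ q ∈ range (m + 1), (-1 : ℤ) ^ q * (genGapSums d q).count c =
      ∑ I, if c - degSum d I ∈ deltaH d then (-1) ^ #I else 0 := by
  rw [← powerset_univ, sum_powerset, card_univ, Fintype.card_fin]
  refine sum_congr rfl fun q _ => ?_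
  rw [count_genGapSums, Nat.cast_sum, mul_sum]
  refine sum_congr rfl fun I hI => ?_
  rw [(mem_powersetCard.1 hI).2]
  split_ifs <;> simp

theorem degSum_compl (I : Finset (Fin m)) : degSum d Iᶜ = sumGen d - degSum d I := by
  rw [degSum, degSum, sumGen, ← sum_compl_add_sum I]
  ring

/-- The functional equation of the graded Euler characteristic. -/
theorem alternating_sum_syzCount_add [CharZero K] (hd : IsMinimalGenerating d)
    (r : MinimalResolution K d) (hm : 0 < m) (c : ℤ) :
    ∑ i ∈ range m, (-1 : ℤ) ^ i * syzCount r i c +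
      (-1) ^ m * ∑ i ∈ range m, (-1 : ℤ) ^ i * syzCount r i (frob d + sumGen d - c) +
      ∑ q ∈ range (m + 1), (-1 : ℤ) ^ q * (genGapSums d q).count c = 0 := by
  classical
  rw [alternating_sum_syzCount hd.pos r hm, alternating_sum_syzCount hd.pos r hm,
    sum_alternating_powersetCard, mul_sum,
    -- Passing to complements in the conjugate sum turns its argument into `F - (c - degSum d I)`,
    -- so the trichotomy `indicator_sgpInt_add` applies for each `I`. The signs `(-1)^#I` left over
    -- add up to zero.
    ← Equiv.sum_comp (Function.Involutive.toPerm (compl : Finset (Fin m) → _) compl_involutive)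
      (fun I => (-1 : ℤ) ^ m *
        if frob d + sumGen d - c - degSum d I ∈ sgpInt d then (-1) ^ #I else 0),
    ← sum_add_distrib, ← sum_add_distrib]
  have h : ∀ I : Finset (Fin m), (if c - degSum d I ∈ sgpInt d then (-1) ^ #I else 0 : ℤ) +
      (-1 : ℤ) ^ m * (if frob d + sumGen d - c - degSum d Iᶜ ∈ sgpInt d then
        (-1) ^ #Iᶜ else 0) + (if c - degSum d I ∈ deltaH d then (-1) ^ #I else 0) =
      (-1) ^ #I := by
    intro I
    have e1 : frob d + sumGen d - c - degSum d Iᶜ = frob d - (c - degSum d I) := by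
      rw [degSum_compl]
      ring
    have e2 : (-1 : ℤ) ^ m = (-1) ^ #I * (-1) ^ #Iᶜ := by
      rw [← pow_add, card_add_card_compl, Fintype.card_fin]
    have e3 : (-1 : ℤ) ^ #Iᶜ * (-1) ^ #Iᶜ = 1 := by
      rw [← mul_pow]
      simp
    have e4 := congrArg (fun z => (-1 : ℤ) ^ #I * z) (indicator_sgpInt_add hd (c - degSum d I))
    simp only [mul_add, mul_one, mul_ite, mul_zero] at e4
    rw [e1, e2, mul_ite, mul_zero, mul_assoc, e3, mul_one]
    exact e4
  refine (sum_congr rfl fun I _ => h I).trans ?_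
  rw [← powerset_univ, sum_powerset_neg_one_pow_card, if_neg]
  exact (univ_nonempty_iff.2 ⟨⟨0, hm⟩⟩).ne_empty

theorem syzCount_zero (r : MinimalResolution K d) (c : ℤ) :
    syzCount r 0 c = if c = 0 then 1 else 0 := by
  simp only [syzCount, r.deg_zero, Nat.cast_zero, eq_comm (a := (0 : ℤ))]
  split_ifs with h
  · simp [h, r.betti_zero]
  · simp [h]

open Classical in
theorem syzCount_pred [CharZero K] (hd : IsMinimalGenerating d) (r : MinimalResolution K d)
    {p : ℕ} (hp : p + 1 = m) (c : ℤ) :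
    syzCount r p c = if c - sumGen d ∈ pseudoFrob d then 1 else 0 := by
  rw [syzCount, card_deg_eq_hdim r hd.pos, hdim_pred_card hd.pos hp]

theorem syzCount_pred_of_isAlmostSymmetric [CharZero K] (hd : IsMinimalGenerating d)
    (has : IsAlmostSymmetric d) (r : MinimalResolution K d) {p : ℕ} (hp : p + 1 = m) (c : ℤ) :
    syzCount r p c = (if c - sumGen d = frob d then 1 else 0) +
      if c - sumGen d ∈ deltaH d then 1 else 0 := by
  classical
  rw [syzCount_pred hd r hp, ite_cond_congr (propext
    (mem_pseudoFrob_iff_of_isAlmostSymmetric hd has (c - sumGen d)))]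
  by_cases h : c - sumGen d = frob d
  · simp [h, frob_notMem_deltaH hd]
  · simp [h]

theorem betti_pred_of_isAlmostSymmetric [CharZero K] (hd : IsMinimalGenerating d)
    (has : IsAlmostSymmetric d) (r : MinimalResolution K d) {p : ℕ} (hp : p + 1 = m) :
    r.betti p = gam d + 1 := by
  classical
  let T : Finset ℤ := (insert (frob d) (deltaH d)).image fun f => f + sumGen d
  have hmem : ∀ c, c ∈ T ↔ c - sumGen d ∈ pseudoFrob d := by
    intro c
    rw [mem_pseudoFrob_iff_of_isAlmostSymmetric hd has, mem_image, ← mem_insert]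
    constructor
    · rintro ⟨f, hf, rfl⟩
      rwa [add_sub_cancel_right]
    · intro h
      exact ⟨_, h, sub_add_cancel _ _⟩
  have h1 : r.betti p = ∑ c ∈ T, syzCount r p c := by
    rw [← Fintype.card_fin (r.betti p), ← card_univ]
    refine card_eq_sum_card_fiberwise fun l _ => ?_
    rw [mem_coe, hmem]
    by_contra h
    have h2 := syzCount_pred hd r hp (r.deg p l)
    rw [if_neg h, syzCount, card_eq_zero, filter_eq_empty_iff] at h2
    exact h2 (mem_univ l) rfl
  rw [h1, sum_congr rfl fun c hc => (syzCount_pred hd r hp c).trans (if_pos ((hmem c).1 hc)),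
    sum_const, smul_eq_mul, mul_one, card_image_of_injective _ (add_left_injective _),
    card_insert_of_notMem (frob_notMem_deltaH hd), gam]

theorem count_genGapSums_zero (c : ℤ) :
    (genGapSums d 0).count c = if c ∈ deltaH d then 1 else 0 := by
  rw [count_genGapSums, powersetCard_zero, sum_singleton]
  simp [degSum]

theorem count_genGapSums_card (c : ℤ) :
    (genGapSums d m).count c = if c - sumGen d ∈ deltaH d then 1 else 0 := by
  have : powersetCard m (univ : Finset (Fin m)) = {univ} := by
    have h := powersetCard_self (univ : Finset (Fin m))
    rwa [card_univ, Fintype.card_fin] at h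
  rw [count_genGapSums, this, sum_singleton, degSum_univ]

/-- The alternating sum of the multiplicities of the intermediate syzygy degrees and of their
conjugates. -/
theorem alternating_sum_Icc [CharZero K] (hd : IsMinimalGenerating d) (has : IsAlmostSymmetric d)
    (r : MinimalResolution K d) {p : ℕ} (hp : p + 2 = m) (c : ℤ) :
    ∑ i ∈ Icc 1 p, (-1 : ℤ) ^ i * (syz r i).count c +
      (-1) ^ m * ∑ i ∈ Icc 1 p, (-1 : ℤ) ^ i * (syzBar r i).count c +
      ∑ q ∈ Icc 1 (p + 1), (-1 : ℤ) ^ q * (genGapSums d q).count c = 0 := by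
  have h := alternating_sum_syzCount_add hd r (by omega) c
  have hR : range m = range (p + 2) := by rw [hp]
  have hR' : range (m + 1) = range (p + 1 + 2) := by rw [← hp]
  rw [hR, hR', sum_range_eq_add_sum_Icc_add, sum_range_eq_add_sum_Icc_add,
    sum_range_eq_add_sum_Icc_add, syzCount_zero, syzCount_zero,
    syzCount_pred_of_isAlmostSymmetric hd has r (show p + 1 + 1 = m by omega),
    syzCount_pred_of_isAlmostSymmetric hd has r (show p + 1 + 1 = m by omega),
    count_genGapSums_zero, show p + 1 + 1 = m from hp, count_genGapSums_card] at h
  simp only [count_syz, count_syzBar]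
  have e1 : frob d + sumGen d - c - sumGen d = frob d - c := by ring
  have e2 : frob d + sumGen d - c = 0 ↔ c - sumGen d = frob d := by
    constructor <;> intro h <;> linarith
  have e3 : frob d - c = frob d ↔ c = 0 := by
    constructor <;> intro h <;> linarith
  -- The extreme terms now cancel in pairs: `c = 0` and `c - Σ_m = F` occur in both syzygy sums,
  -- while the `Δ_H` parts of the last syzygies meet the terms `q = 0` and `q = m`.
  simp only [e1, e2, e3, frob_sub_mem_deltaH hd] at h
  have hs : ((-1 : ℤ) ^ p) * (-1) ^ p = 1 := by
    rw [← mul_pow]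
    simp
  have hmp : (-1 : ℤ) ^ m = (-1) ^ p := by
    rw [← hp, pow_add]
    simp
  rw [hmp] at h ⊢
  rw [pow_succ (-1 : ℤ) p] at h
  push_cast at h
  linear_combination h + ((if c = 0 then 1 else 0) + (if c ∈ deltaH d then 1 else 0)) * hs

theorem count_sum_filter (s : Finset ℕ) (P : ℕ → Prop) [DecidablePred P] (g : ℕ → Multiset ℤ)
    (c : ℤ) : ((∑ i ∈ s with P i, g i).count c : ℤ) = ∑ i ∈ s with P i, ((g i).count c : ℤ) := by
  rw [Multiset.count_sum', Nat.cast_sum]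

theorem syzX2_add_genGapEven [CharZero K] (hd : IsMinimalGenerating d)
    (has : IsAlmostSymmetric d) (r : MinimalResolution K d) (hm : 2 ≤ m) :
    syzX2 r + genGapEven d = syzX1 r + genGapOdd d := by
  ext c
  zify
  rw [Multiset.count_add, Multiset.count_add]
  push_cast
  have h := alternating_sum_Icc hd has r (show m - 2 + 2 = m by omega) c
  rw [show m - 2 + 1 = m - 1 by omega, ← sum_even_sub_sum_odd, ← sum_even_sub_sum_odd,
    ← sum_even_sub_sum_odd] at h
  simp only [← count_sum_filter] at h
  change ((syzEven r).count c - (syzOdd r).count c : ℤ) +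
    (-1) ^ m * ((syzBarEven r).count c - (syzBarOdd r).count c) +
    ((genGapEven d).count c - (genGapOdd d).count c) = 0 at h
  unfold syzX1 syzX2
  rcases Nat.even_or_odd m with h' | h'
  · rw [h'.neg_one_pow] at h
    rw [if_pos h', if_pos h', Multiset.count_add, Multiset.count_add]
    push_cast
    linarith
  · rw [h'.neg_one_pow] at h
    rw [if_neg (Nat.not_even_iff_odd.2 h'), if_neg (Nat.not_even_iff_odd.2 h'),
      Multiset.count_add, Multiset.count_add]
    push_cast
    linarith

/-- Pointwise `x₂ - x₁ = l₁ - l₂`, so `x₁` is the smaller of its pair exactly when `l₂` is. -/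
theorem card_inter_add_card_eq {α : Type*} [DecidableEq α] {X₁ X₂ L₁ L₂ : Multiset α}
    (h : X₂ + L₂ = X₁ + L₁) :
    Multiset.card (X₁ ∩ X₂) + Multiset.card L₂ = Multiset.card (L₂ ∩ L₁) + Multiset.card X₁ := by
  rw [← Multiset.card_add, ← Multiset.card_add]
  congr 1
  ext a
  have := congrArg (Multiset.count a) h
  simp only [Multiset.count_add, Multiset.count_inter] at this ⊢
  omega

theorem two_mul_delta [CharZero K] (hd : IsMinimalGenerating d) (has : IsAlmostSymmetric d)
    (r : MinimalResolution K d) (hm : 2 ≤ m) :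
    2 * delta r + gam d * ∑ q ∈ Icc 1 (m - 1), (m.choose q : ℤ) =
      2 * ∑ i ∈ Icc 1 (m - 2), (r.betti i : ℤ) := by
  have h := syzX2_add_genGapEven hd has r hm
  have h1 := card_inter_add_card_eq h
  -- Thus `δ` equals both `#𝔛₁ - #𝔏_e` and `#𝔛₂ - #𝔏_o`. Adding the two requires only the total
  -- cardinalities, hence the factor 2.
  have h2 : Multiset.card (syzX2 r) + Multiset.card (genGapEven d) =
      Multiset.card (syzX1 r) + Multiset.card (genGapOdd d) := by
    rw [← Multiset.card_add, h, Multiset.card_add]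
  have hX : Multiset.card (syzX1 r) + Multiset.card (syzX2 r) =
      2 * ∑ i ∈ Icc 1 (m - 2), r.betti i := by
    have e1 : Multiset.card (syzEven r) + Multiset.card (syzOdd r) =
        ∑ i ∈ Icc 1 (m - 2), r.betti i := by
      simp only [syzEven, syzOdd, Multiset.card_sum, card_syz, sum_even_add_sum_odd]
    have e2 : Multiset.card (syzBarEven r) + Multiset.card (syzBarOdd r) =
        ∑ i ∈ Icc 1 (m - 2), r.betti i := by
      simp only [syzBarEven, syzBarOdd, Multiset.card_sum, card_syzBar, sum_even_add_sum_odd]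
    unfold syzX1 syzX2
    split_ifs <;> simp only [Multiset.card_add] <;> omega
  have hL : Multiset.card (genGapEven d) + Multiset.card (genGapOdd d) =
      gam d * ∑ q ∈ Icc 1 (m - 1), m.choose q := by
    simp only [genGapEven, genGapOdd, Multiset.card_sum, card_genGapSums, sum_even_add_sum_odd]
    rw [← sum_mul, mul_comm]
  unfold delta wp ell
  zify at h1 h2 hX hL
  linarith

end AlmostSymmetric

end NumSgp

theorem corollary2 {K : Type*} [Field K] [CharZero K] (m : ℕ) (hm : 2 ≤ m) (d : Fin m → ℕ)
    (hd : NumSgp.IsMinimalGenerating d) (has : NumSgp.IsAlmostSymmetric d)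
    (r : NumSgp.MinimalResolution K d) :
    NumSgp.delta r ≤
      ((d ⟨0, by omega⟩ : ℤ) - (NumSgp.gam d : ℤ)) * 2 ^ (m - 1) - 2 * (m : ℤ) := by
  have h1 := NumSgp.two_mul_delta hd has r hm
  have h2 := NumSgp.sum_betti_add_le hd r ⟨0, by omega⟩
  have h3 := Nat.sum_range_choose m
  have h4 := NumSgp.betti_pred_of_isAlmostSymmetric hd has r (show m - 1 + 1 = m by omega)
  obtain ⟨p, rfl⟩ : ∃ p, m = p + 2 := ⟨m - 2, by omega⟩
  simp only [Nat.add_sub_cancel, show p + 2 - 1 = p + 1 by omega] at h1 h2 h4 ⊢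
  -- Removing `β_0 + β_{m-1} = γ + 2` completes `2 (m - 1)` to `2 m`; the extra `-γ` is offset by
  -- the `+γ` in `-γ (2^(m-1) - 1)`.
  rw [NumSgp.sum_range_eq_add_sum_Icc_add, r.betti_zero, h4] at h2
  rw [show p + 2 + 1 = p + 1 + 2 by ring, NumSgp.sum_range_eq_add_sum_Icc_add,
    Nat.choose_zero_right, show p + 1 + 1 = p + 2 by ring, Nat.choose_self] at h3
  zify at h2 h3
  have h5 : ∑ q ∈ Finset.Icc 1 (p + 1), ((p + 2).choose q : ℤ) = 2 * 2 ^ (p + 1) - 2 := by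
    rw [pow_succ] at h3
    linarith
  rw [h5] at h1
  push_cast
  linarith
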